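/- Let $G_{\mathrm{SM}} = \mathrm{U}(1)\times \mathrm{SU}(2)\times \mathrm{SU}(3)$, let $\phi : G_{\mathrm{SM}} \to \mathrm{SU}(5)$ be the homomorphism $\phi(\alpha,A,B) = \operatorname{diag}(\alpha^{3}A,\ \alpha^{-2}B)$, and let $\mathbb{Z}_6 \subset G_{\mathrm{SM}}$ be the subgroup of all $(\alpha, \alpha^{-3}, \alpha^{2})$ with $\alpha^6 = 1$. For $3Y\in\mathbb{Z}$ let $\mathbb{C}_Y$ be $\mathbb{C}$ with $\alpha\in \mathrm{U}(1)$ acting by $\alpha^{3Y}$; let $\mathbb{C}^2$, $\mathbb{C}^3$ be the fundamental representations of $\mathrm{SU}(2)$, $\mathrm{SU}(3)$ and $\mathbb{C}$ a trivial representation. Let $$F = (\mathbb{C}_{-1}\otimes\mathbb{C}^2\otimes\mathbb{C}) \oplus (\mathbb{C}_{1/3}\otimes\mathbb{C}^2\otimes\mathbb{C}^3) \oplus (\mathbb{C}_{0}\otimes\mathbb{C}\otimes\mathbb{C}) \oplus (\mathbb{C}_{-2}\otimes\mathbb{C}\otimes\mathbb{C}) \oplus (\mathbb{C}_{4/3}\otimes\mathbb{C}\otimes\mathbb{C}^3)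 \oplus (\mathbb{C}_{-2/3}\otimes\mathbb{C}\otimes\mathbb{C}^3)$$ as a representation of $G_{\mathrm{SM}}$, and let $\overline{F}$ be its dual. Let $\mathrm{Spin}(10)$ be the compact spin group inside the real Clifford algebra of $\mathbb{R}^{10}$ with relations $v^2 = -\langle v,v\rangle$. Its Dirac spinor representation $\rho'$ on $\Lambda^*\mathbb{C}^5$ is the restriction of the Clifford action in which $v \in \mathbb{R}^{10}$ acts by $z\wedge\cdot - \iota_z$, where $z\in\mathbb{C}^5$ corresponds to $v$ under $z_r = v_{2r-1} - i v_{2r}$ and $\iota_z$ is contraction with $z$ by the Hermitian inner product. Put $\Delta^+ = \Lambda^{\mathrm{even}}\mathbb{C}^5$ and $\Delta^- = \Lambda^{\mathrm{odd}}\mathbb{C}^5$. Let $\rho$ be the natural representation of $\mathrm{SU}(5)$ on $\Lambda^*\mathbb{C}^5$. Theorem ("$\mathrm{Spin}(10)$ is a grand unified theory"). (1) $\mathbb{Z}_6$ is cyclic of order $6$, and it is the kernel of $\phi$. (2) $\Lambda^*\mathbb{C}^5 = \Delta^+\oplus\Delta^-$ as representations of $\mathrm{Spin}(10)$, and $\Delta^+$,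 $\Delta^-$ are irreducible and inequivalent. (3) There is an injective continuous (hence Lie group) homomorphism $\psi : \mathrm{SU}(5)\to \mathrm{Spin}(10)$ with $\rho'\circ\psi = \rho$; the composite $\psi\circ\phi$ descends to a homomorphism $j : G_{\mathrm{SM}}/\mathbb{Z}_6 \hookrightarrow \mathrm{Spin}(10)$ which is a closed topological embedding. (4) The representation $F\oplus\overline{F}$ of $G_{\mathrm{SM}}$ descends to $G_{\mathrm{SM}}/\mathbb{Z}_6$, and the resulting representation is equivalent to $\rho'\circ j$; that is, the following diagram commutes: $$\begin{array}{ccc} G_{\mathrm{SM}}/\mathbb{Z}_6 & \hookrightarrow & \mathrm{Spin}(10)\\ \downarrow & & \downarrow{\scriptstyle\rho'}\\ F\oplus\overline{F} & \xrightarrow{\ \cong\ } & \Lambda^*\mathbb{C}^5\end{array}$$ -/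

import Mathlib

open scoped TensorProduct

namespace SpinGUT

noncomputable section

/-! ### The Standard Model gauge group and its homomorphism to `SU(5)` -/

/-- The special unitary group `SU(n)`. -/
abbrev SU (n : ℕ) : Type := ↥(Matrix.specialUnitaryGroup (Fin n) ℂ)

/-- The Standard Model gauge group `U(1) × SU(2) × SU(3)`. -/
abbrev GSM : Type := Circle × SU 2 × SU 3

/-- The block matrix `diag(α³ A, α⁻² B)`. -/
def blockMatrix (g : GSM) : Matrix (Fin 2 ⊕ Fin 3) (Fin 2 ⊕ Fin 3) ℂ :=
  Matrix.fromBlocks (((g.1 ^ 3 : Circle) : ℂ) • (g.2.1 : Matrix (Fin 2) (Fin 2) ℂ)) 0 0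
    (((g.1⁻¹ ^ 2 : Circle) : ℂ) • (g.2.2 : Matrix (Fin 3) (Fin 3) ℂ))

theorem blockMatrix_one : blockMatrix 1 = 1 := by
  simp [blockMatrix]

theorem blockMatrix_mul (g h : GSM) : blockMatrix (g * h) = blockMatrix g * blockMatrix h := by
  simp [blockMatrix, Matrix.fromBlocks_multiply, mul_pow, smul_smul, mul_comm]

theorem det_blockMatrix (g : GSM) : (blockMatrix g).det = 1 := by
  obtain ⟨a, A, B⟩ := g
  have hA := (Matrix.mem_specialUnitaryGroup_iff.1 A.2).2
  have hB := (Matrix.mem_specialUnitaryGroup_iff.1 B.2).2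
  have ha : (a : ℂ) ≠ 0 := Circle.coe_ne_zero a
  simp only [blockMatrix, Matrix.det_fromBlocks_zero₂₁, Matrix.det_smul, hA, hB, Fintype.card_fin,
    Circle.coe_pow, Circle.coe_inv]
  field_simp

theorem star_blockMatrix (g : GSM) : star (blockMatrix g) = blockMatrix g⁻¹ := by
  obtain ⟨a, A, B⟩ := g
  have ha : (starRingEnd ℂ) (a : ℂ) = ((a⁻¹ : Circle) : ℂ) := (Circle.coe_inv_eq_conj a).symm
  have ha' : (starRingEnd ℂ) ((a⁻¹ : Circle) : ℂ) = (a : ℂ) := by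
    rw [← ha, Complex.conj_conj]
  simp only [blockMatrix, Matrix.star_eq_conjTranspose, Matrix.fromBlocks_conjTranspose,
    Matrix.conjTranspose_smul, Matrix.conjTranspose_zero, Prod.fst_inv, Prod.snd_inv,
    Circle.coe_pow, star_pow, RCLike.star_def, ha, ha', inv_inv]
  rfl

theorem reindex_blockMatrix_mem (g : GSM) :
    Matrix.reindexAlgEquiv ℂ ℂ finSumFinEquiv (blockMatrix g) ∈
      Matrix.specialUnitaryGroup (Fin 5) ℂ := by
  rw [Matrix.mem_specialUnitaryGroup_iff]
  refine ⟨?_, ?_⟩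
  · rw [Matrix.mem_unitaryGroup_iff]
    have h : star (Matrix.reindexAlgEquiv ℂ ℂ finSumFinEquiv (blockMatrix g)) =
        Matrix.reindexAlgEquiv ℂ ℂ finSumFinEquiv (blockMatrix g⁻¹) := by
      rw [← star_blockMatrix]; rfl
    have h2 := map_mul (Matrix.reindexAlgEquiv ℂ ℂ (finSumFinEquiv (m := 2) (n := 3)))
      (blockMatrix g) (blockMatrix g⁻¹)
    rw [← blockMatrix_mul, mul_inv_cancel, blockMatrix_one, map_one] at h2
    exact (congrArg _ h).trans h2.symm
  · exact (Matrix.det_reindexAlgEquiv ℂ ℂ _ _).trans (det_blockMatrix g)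

/-- The homomorphism `φ : G_SM → SU(5)`, `(α, A, B) ↦ diag(α³ A, α⁻² B)`. -/
def phi : GSM →* SU 5 where
  toFun g := ⟨Matrix.reindexAlgEquiv ℂ ℂ finSumFinEquiv (blockMatrix g), reindex_blockMatrix_mem g⟩
  map_one' := Subtype.ext (by
    change Matrix.reindexAlgEquiv ℂ ℂ finSumFinEquiv (blockMatrix 1) = 1
    rw [blockMatrix_one]; exact map_one _)
  map_mul' g h := Subtype.ext (by
    change Matrix.reindexAlgEquiv ℂ ℂ finSumFinEquiv (blockMatrix (g * h)) = _
    rw [blockMatrix_mul]; exact map_mul _ _ _)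

/-- The subgroup `ℤ₆` of `G_SM`: all `(α, α⁻³, α²)` with `α` a sixth root of unity. -/
def Z6 : Subgroup GSM where
  carrier := {g | g.1 ^ 6 = 1 ∧
    (g.2.1 : Matrix (Fin 2) (Fin 2) ℂ) = Matrix.scalar (Fin 2) ((g.1⁻¹ ^ 3 : Circle) : ℂ) ∧
    (g.2.2 : Matrix (Fin 3) (Fin 3) ℂ) = Matrix.scalar (Fin 3) ((g.1 ^ 2 : Circle) : ℂ)}
  one_mem' := by simp
  mul_mem' := by
    rintro g h ⟨hg1, hg2, hg3⟩ ⟨hh1, hh2, hh3⟩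
    refine ⟨by simp [mul_pow, hg1, hh1], ?_, ?_⟩
    · simp only [Prod.fst_mul, Prod.snd_mul, Submonoid.coe_mul, hg2, hh2, mul_inv, mul_pow,
        Circle.coe_mul, map_mul]
    · simp only [Prod.fst_mul, Prod.snd_mul, Submonoid.coe_mul, hg3, hh3, mul_pow,
        Circle.coe_mul, map_mul]
  inv_mem' := by
    rintro g ⟨h1, h2, h3⟩
    refine ⟨by simp [h1], ?_, ?_⟩
    · change star (g.2.1 : Matrix (Fin 2) (Fin 2) ℂ) = _
      rw [h2]
      have ha : (starRingEnd ℂ) (g.1 : ℂ) = (g.1 : ℂ)⁻¹ := by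
        rw [← Circle.coe_inv_eq_conj, Circle.coe_inv]
      simp [Matrix.star_eq_conjTranspose, Matrix.diagonal_conjTranspose, ha]
    · change star (g.2.2 : Matrix (Fin 3) (Fin 3) ℂ) = _
      rw [h3]
      have ha : (starRingEnd ℂ) (g.1 : ℂ) = (g.1 : ℂ)⁻¹ := by
        rw [← Circle.coe_inv_eq_conj, Circle.coe_inv]
      simp [Matrix.star_eq_conjTranspose, Matrix.diagonal_conjTranspose, ha]

instance : Z6.Normal where
  conj_mem := by
    rintro g ⟨h1, h2, h3⟩ x
    have e : x * g * x⁻¹ = g := by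
      rw [mul_inv_eq_iff_eq_mul]
      refine Prod.ext (mul_comm _ _) (Prod.ext (Subtype.ext ?_) (Subtype.ext ?_))
      · change (x.2.1 : Matrix (Fin 2) (Fin 2) ℂ) * g.2.1 = g.2.1 * x.2.1
        rw [h2]
        exact (Matrix.scalar_commute _ (fun _ => Commute.all _ _) _).eq.symm
      · change (x.2.2 : Matrix (Fin 3) (Fin 3) ℂ) * g.2.2 = g.2.2 * x.2.2
        rw [h3]
        exact (Matrix.scalar_commute _ (fun _ => Commute.all _ _) _).eq.symm
    rw [e]
    exact ⟨h1, h2, h3⟩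

/-! ### The Standard Model representation -/

/-- The representation `ℂ_Y` of `U(1)` with hypercharge `Y = k / 3`, that is, `α · z = α^(3Y) z`
with `3Y = k` an integer. -/
def hypercharge (k : ℤ) : Representation ℂ Circle ℂ where
  toFun a := ((a ^ k : Circle) : ℂ) • LinearMap.id
  map_one' := by ext; simp
  map_mul' a b := by ext; simp [mul_zpow, mul_comm]

/-- The fundamental representation of `SU(n)` on `ℂⁿ`. -/
def fundamental (n : ℕ) : Representation ℂ (SU n) (Fin n → ℂ) where
  toFun A := Matrix.toLin' (A : Matrix (Fin n) (Fin n) ℂ)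
  map_one' := Matrix.toLin'_one
  map_mul' A B := by simp [Matrix.toLin'_mul, Module.End.mul_eq_comp]

/-- The one-dimensional trivial representation of `SU(n)` on `ℂ`. -/
def singlet (n : ℕ) : Representation ℂ (SU n) ℂ := Representation.trivial ℂ (SU n) ℂ

/-- The (external) tensor product `ℂ_Y ⊗ V ⊗ W` as a representation of `G_SM`, where `Y = k / 3`
and `V`, `W` are representations of `SU(2)` and `SU(3)`. -/
def particle {V W : Type} [AddCommGroup V] [Module ℂ V] [AddCommGroup W] [Module ℂ W]
    (k : ℤ) (σ : Representation ℂ (SU 2) V) (τ : Representation ℂ (SU 3) W) :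
    Representation ℂ GSM (ℂ ⊗[ℂ] (V ⊗[ℂ] W)) :=
  Representation.tprod (MonoidHom.comp (hypercharge k) (MonoidHom.fst Circle (SU 2 × SU 3)))
    (Representation.tprod
      (MonoidHom.comp σ
        ((MonoidHom.fst (SU 2) (SU 3)).comp (MonoidHom.snd Circle (SU 2 × SU 3))))
      (MonoidHom.comp τ
        ((MonoidHom.snd (SU 2) (SU 3)).comp (MonoidHom.snd Circle (SU 2 × SU 3)))))

/-- Left-handed leptons `(ν_L, e⁻_L)`: `ℂ_{-1} ⊗ ℂ² ⊗ ℂ`. -/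
def leptonL := particle (-3) (fundamental 2) (singlet 3)

/-- Left-handed quarks `(u_L, d_L)`: `ℂ_{1/3} ⊗ ℂ² ⊗ ℂ³`. -/
def quarkL := particle 1 (fundamental 2) (fundamental 3)

/-- The right-handed neutrino: `ℂ_0 ⊗ ℂ ⊗ ℂ`. -/
def neutrinoR := particle 0 (singlet 2) (singlet 3)

/-- The right-handed electron: `ℂ_{-2} ⊗ ℂ ⊗ ℂ`. -/
def electronR := particle (-6) (singlet 2) (singlet 3)

/-- Right-handed up quarks: `ℂ_{4/3} ⊗ ℂ ⊗ ℂ³`. -/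
def upR := particle 4 (singlet 2) (fundamental 3)

/-- Right-handed down quarks: `ℂ_{-2/3} ⊗ ℂ ⊗ ℂ³`. -/
def downR := particle (-2) (singlet 2) (fundamental 3)

/-- The fermion representation `F`: the direct sum of the six irreps of the first generation. -/
def fermionRep :=
  leptonL.prod (quarkL.prod (neutrinoR.prod (electronR.prod (upR.prod downR))))

/-- The underlying space of `F`. -/
abbrev FermionSpace : Type :=
  (ℂ ⊗[ℂ] ((Fin 2 → ℂ) ⊗[ℂ] ℂ)) × (ℂ ⊗[ℂ] ((Fin 2 → ℂ) ⊗[ℂ] (Fin 3 → ℂ))) ×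
    (ℂ ⊗[ℂ] (ℂ ⊗[ℂ] ℂ)) × (ℂ ⊗[ℂ] (ℂ ⊗[ℂ] ℂ)) ×
    (ℂ ⊗[ℂ] (ℂ ⊗[ℂ] (Fin 3 → ℂ))) × (ℂ ⊗[ℂ] (ℂ ⊗[ℂ] (Fin 3 → ℂ)))

/-- The Standard Model representation `F ⊕ F̄`, where `F̄` (the antifermions) is the dual of `F`. -/
def standardModelRep : Representation ℂ GSM (FermionSpace × Module.Dual ℂ FermionSpace) :=
  Representation.prod fermionRep (Representation.dual fermionRep)

/-! ### The group `Spin(10)` -/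

/-- The quadratic form `v ↦ -⟨v, v⟩` on `ℝ¹⁰`. -/
def negForm : QuadraticForm ℝ (Fin 10 → ℝ) :=
  -QuadraticMap.weightedSumSquares ℝ (fun _ : Fin 10 => (1 : ℝ))

/-- `Spin(10)`, inside the real Clifford algebra of `ℝ¹⁰` with relations `v ^ 2 = -⟨v, v⟩`. -/
abbrev Spin10 : Type := ↥(spinGroup negForm)

/-- The Clifford algebra carries the usual topology of a finite-dimensional real vector space;
`Spin(10)` has the subspace topology. -/
instance : TopologicalSpace (CliffordAlgebra negForm) :=
  moduleTopology ℝ (CliffordAlgebra negForm)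

/-! ### The exterior algebra and the Dirac spinor representation -/

/-- The exterior algebra `Λ*ℂ⁵`. -/
abbrev Ext5 : Type := ExteriorAlgebra ℂ (Fin 5 → ℂ)

/-- The representation `ρ` of `SU(5)` on `Λ*ℂ⁵`: fundamental on `Λ¹`, respecting wedge products. -/
def exteriorRep : Representation ℂ (SU 5) Ext5 where
  toFun A := (ExteriorAlgebra.map (fundamental 5 A)).toLinearMap
  map_one' := by
    rw [map_one]
    exact congrArg AlgHom.toLinearMap ExteriorAlgebra.map_id
  map_mul' A B := by
    rw [map_mul]
    exact congrArg AlgHom.toLinearMap (ExteriorAlgebra.map_comp_map _ _).symm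

/-- The identification `ℝ¹⁰ ≃ ℂ⁵`, `z_r = v_{2r-1} - i v_{2r}` (in one-based indices). It is the one
under which `A₁ + i A₂ ∈ SU(5)` acts on `(v_odd, v_even)` by `((A₁, A₂), (-A₂, A₁))`. With this
choice every `e_{2r-1} e_{2r}` acts on `1 ∈ Λ⁰` as `i`, so that the spinor weights
`½(±x₁ ± ⋯ ± x₅)` with an even number of minus signs are those of `Λ^even`. -/
def toComplex : (Fin 10 → ℝ) →ₗ[ℝ] (Fin 5 → ℂ) where
  toFun v r := (v ⟨2 * r, by omega⟩ : ℂ) - Complex.I * (v ⟨2 * r + 1, by omega⟩ : ℂ)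
  map_add' v w := by ext r; simp; ring
  map_smul' c v := by ext r; simp; ring

/-- The linear functional `w ↦ ⟨z, w⟩ = ∑ conj(z_r) w_r` on `ℂ⁵`. -/
def hermFunctional (z : Fin 5 → ℂ) : Module.Dual ℂ (Fin 5 → ℂ) :=
  ∑ r, (starRingEnd ℂ (z r)) • LinearMap.proj r

/-- The creation operator `l_z : ξ ↦ z ∧ ξ`. -/
def create (z : Fin 5 → ℂ) : Module.End ℂ Ext5 :=
  LinearMap.mulLeft ℂ (ExteriorAlgebra.ι ℂ z)

/-- The annihilation operator `ι_z`, contraction with `z` by the Hermitian inner product;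
it is the adjoint of `create z`. -/
def annihilate (z : Fin 5 → ℂ) : Module.End ℂ Ext5 :=
  CliffordAlgebra.contractLeft (Q := (0 : QuadraticForm ℂ (Fin 5 → ℂ))) (hermFunctional z)

/-- Clifford multiplication of forms: `v` acts on `Λ*ℂ⁵` as `l_z - ι_z`, where `z` is the
vector of `ℂ⁵` corresponding to `v`. -/
def cliffordMul : (Fin 10 → ℝ) →ₗ[ℝ] Module.End ℂ Ext5 where
  toFun v := create (toComplex v) - annihilate (toComplex v)
  map_add' v w := by
    have h : hermFunctional (toComplex v + toComplex w) =
        hermFunctional (toComplex v) + hermFunctional (toComplex w) := by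
      simp [hermFunctional, add_smul, Finset.sum_add_distrib]
    ext x
    simp [create, annihilate, h, add_mul]
    abel
  map_smul' c v := by
    have h : hermFunctional (c • toComplex v) = (c : ℂ) • hermFunctional (toComplex v) := by
      simp [hermFunctional, Finset.smul_sum, smul_smul]
    have h' : c • toComplex v = (c : ℂ) • toComplex v := by ext r; simp
    apply LinearMap.ext
    intro x
    rw [map_smul, h', create, annihilate, ← h', h, h', map_smul, map_smul]
    change ((c : ℂ) • ExteriorAlgebra.ι ℂ (toComplex v)) * x - (c : ℂ) • _ = (c : ℝ) • (_ - _)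
    rw [smul_mul_assoc, ← smul_sub]
    exact Complex.coe_smul c _

theorem cliffordMul_sq (v : Fin 10 → ℝ) :
    cliffordMul v * cliffordMul v = algebraMap ℝ (Module.End ℂ Ext5) (negForm v) := by
  have hv : hermFunctional (toComplex v) (toComplex v) = ((-negForm v : ℝ) : ℂ) := by
    simp [hermFunctional, toComplex, negForm, QuadraticMap.weightedSumSquares_apply,
      Fin.sum_univ_succ]
    ring_nf
    simp
    ring
  apply LinearMap.ext
  intro x
  have h0 : ExteriorAlgebra.ι ℂ (toComplex v) * (ExteriorAlgebra.ι ℂ (toComplex v) * x) = 0 := by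
    rw [← mul_assoc, ExteriorAlgebra.ι_sq_zero, zero_mul]
  have h1 := CliffordAlgebra.contractLeft_contractLeft (Q := (0 : QuadraticForm ℂ (Fin 5 → ℂ)))
    (hermFunctional (toComplex v)) x
  have h2 := CliffordAlgebra.contractLeft_ι_mul (Q := (0 : QuadraticForm ℂ (Fin 5 → ℂ)))
    (hermFunctional (toComplex v)) (toComplex v) x
  have e : (algebraMap ℝ (Module.End ℂ Ext5) (negForm v)) x = ((negForm v : ℝ) : ℂ) • x :=
    (Complex.coe_smul _ x).symm
  rw [e]
  change ExteriorAlgebra.ι ℂ (toComplex v) * (ExteriorAlgebra.ι ℂ (toComplex v) * x -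
      CliffordAlgebra.contractLeft (Q := (0 : QuadraticForm ℂ (Fin 5 → ℂ)))
        (hermFunctional (toComplex v)) x) -
    CliffordAlgebra.contractLeft (Q := (0 : QuadraticForm ℂ (Fin 5 → ℂ)))
      (hermFunctional (toComplex v)) (ExteriorAlgebra.ι ℂ (toComplex v) * x -
        CliffordAlgebra.contractLeft (Q := (0 : QuadraticForm ℂ (Fin 5 → ℂ)))
          (hermFunctional (toComplex v)) x) = _
  rw [mul_sub, h0, map_sub, h1]
  change 0 - _ - (CliffordAlgebra.contractLeft (Q := (0 : QuadraticForm ℂ (Fin 5 → ℂ)))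
    (hermFunctional (toComplex v)) (CliffordAlgebra.ι 0 (toComplex v) * x) - 0) = _
  rw [h2, hv, Complex.ofReal_neg, neg_smul]
  change 0 - (CliffordAlgebra.ι 0 (toComplex v) * _) - _ = _
  abel

/-- The action of the Clifford algebra on `Λ*ℂ⁵` by Clifford multiplication of forms. -/
def cliffordAction : CliffordAlgebra negForm →ₐ[ℝ] Module.End ℂ Ext5 :=
  CliffordAlgebra.lift negForm ⟨cliffordMul, cliffordMul_sq⟩

/-- The Dirac spinor representation `ρ'` of `Spin(10)` on `Λ*ℂ⁵`. -/
def diracRep : Representation ℂ Spin10 Ext5 :=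
  (cliffordAction : CliffordAlgebra negForm →* Module.End ℂ Ext5).comp
    (spinGroup negForm).subtype

/-- The sum of the exterior powers `Λᵏℂ⁵` with `k ≡ i` modulo `2`. -/
def extParity (i : ZMod 2) : Submodule ℂ Ext5 :=
  ⨆ k : {n : ℕ // (n : ZMod 2) = i}, ⋀[ℂ]^(k : ℕ) (Fin 5 → ℂ)

theorem create_mem {i : ZMod 2} (z : Fin 5 → ℂ) {x : Ext5} (hx : x ∈ extParity i) :
    create z x ∈ extParity (i + 1) := by
  have h := SetLike.mul_mem_graded
    (A := CliffordAlgebra.evenOdd (0 : QuadraticForm ℂ (Fin 5 → ℂ)))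
    (CliffordAlgebra.ι_mem_evenOdd_one (0 : QuadraticForm ℂ (Fin 5 → ℂ)) z) hx
  rw [add_comm] at h
  exact h

theorem annihilate_mem {i : ZMod 2} (z : Fin 5 → ℂ) {x : Ext5} (hx : x ∈ extParity i) :
    annihilate z x ∈ extParity (i + 1) := by
  have hc : ∀ (m : Fin 5 → ℂ) (y : Ext5), annihilate z (create m y) =
      hermFunctional z m • y - create m (annihilate z y) := fun m y =>
    CliffordAlgebra.contractLeft_ι_mul (Q := (0 : QuadraticForm ℂ (Fin 5 → ℂ)))
      (hermFunctional z) m y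
  have h2 : ∀ j : ZMod 2, j + 1 + 1 = j := by decide
  change x ∈ CliffordAlgebra.evenOdd (0 : QuadraticForm ℂ (Fin 5 → ℂ)) i at hx
  induction x, hx using CliffordAlgebra.evenOdd_induction with
  | range_ι_pow v h =>
    have hi : ∀ j : ZMod 2, j = 0 ∨ j = 1 := by decide
    rcases hi i with rfl | rfl
    · obtain ⟨r, rfl⟩ := Submodule.mem_one.mp h
      have e : annihilate z (algebraMap ℂ Ext5 r) = 0 :=
        CliffordAlgebra.contractLeft_algebraMap (Q := (0 : QuadraticForm ℂ (Fin 5 → ℂ)))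
          (hermFunctional z) r
      exact e ▸ zero_mem _
    · have h' : v ∈ LinearMap.range (CliffordAlgebra.ι (0 : QuadraticForm ℂ (Fin 5 → ℂ))) ^ 1 := h
      rw [pow_one] at h'
      obtain ⟨m, rfl⟩ := h'
      have e : annihilate z (CliffordAlgebra.ι 0 m) = algebraMap ℂ Ext5 (hermFunctional z m) :=
        CliffordAlgebra.contractLeft_ι (Q := (0 : QuadraticForm ℂ (Fin 5 → ℂ)))
          (hermFunctional z) m
      rw [e]
      exact SetLike.algebraMap_mem_graded
        (CliffordAlgebra.evenOdd (0 : QuadraticForm ℂ (Fin 5 → ℂ))) _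
  | add x y _ _ hx hy =>
    rw [map_add]
    exact add_mem hx hy
  | ι_mul_ι_mul m₁ m₂ x hx ih =>
    have hx' : x ∈ extParity i := hx
    have e : CliffordAlgebra.ι 0 m₁ * CliffordAlgebra.ι 0 m₂ * x = create m₁ (create m₂ x) :=
      mul_assoc _ _ _
    rw [e, hc, hc]
    refine sub_mem (Submodule.smul_mem _ _ (create_mem _ hx')) ?_
    rw [map_sub, map_smul]
    refine sub_mem (Submodule.smul_mem _ _ (create_mem _ hx')) ?_
    have := create_mem m₁ (create_mem m₂ ih)
    rwa [h2] at this

theorem cliffordAction_even_mem (a : CliffordAlgebra negForm)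
    (ha : a ∈ CliffordAlgebra.evenOdd negForm 0) {i : ZMod 2} {x : Ext5} (hx : x ∈ extParity i) :
    cliffordAction a x ∈ extParity i := by
  have hv : ∀ (v : Fin 10 → ℝ) {j : ZMod 2} {y : Ext5}, y ∈ extParity j →
      cliffordAction (CliffordAlgebra.ι negForm v) y ∈ extParity (j + 1) := by
    intro v j y hy
    rw [cliffordAction, CliffordAlgebra.lift_ι_apply]
    exact sub_mem (create_mem _ hy) (annihilate_mem _ hy)
  induction a, ha using CliffordAlgebra.even_induction with
  | algebraMap r =>
    rw [AlgHom.commutes]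
    have e : algebraMap ℝ (Module.End ℂ Ext5) r x = (r : ℂ) • x := (Complex.coe_smul r x).symm
    rw [e]
    exact Submodule.smul_mem _ _ hx
  | add a b _ _ h1 h2 =>
    rw [map_add]
    exact add_mem h1 h2
  | ι_mul_ι_mul m₁ m₂ a _ h =>
    rw [map_mul, map_mul]
    have := hv m₁ (hv m₂ h)
    rw [add_assoc, show (1 + 1 : ZMod 2) = 0 from rfl, add_zero] at this
    exact this

/-- The Weyl spinor representations of `Spin(10)` as subrepresentations of `Λ*ℂ⁵`. -/
def weyl (i : ZMod 2) : Subrepresentation diracRep where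
  toSubmodule := extParity i
  apply_mem_toSubmodule g _ hv := cliffordAction_even_mem g.1 (spinGroup.mem_even g.2) hv

/-- Left-handed Weyl spinors `Δ⁺ = Λ^even ℂ⁵`. -/
def deltaPlus : Subrepresentation diracRep := weyl 0

/-- Right-handed Weyl spinors `Δ⁻ = Λ^odd ℂ⁵`. -/
def deltaMinus : Subrepresentation diracRep := weyl 1

end

end SpinGUT

open SpinGUT

namespace SpinGUT

noncomputable section

/-! ### Creation and annihilation operators -/

/-! The forms `Λ*ℂ⁵` are a Fock space. The operators `empty i` project onto the forms that do not
involve the `i`-th basis vector, and their product is the projection onto the vacuum line of scalars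
(`vacuum_projection`). Hence a nonzero subspace stable under annihilation has an element with
nonzero scalar part, and if it is also stable under creation it contains `1` and so everything
(`eq_bot_or_eq_top`). The same projection produces all rank one operators, so the image of the
Clifford algebra spans `End(Λ*ℂ⁵)` over `ℂ`; since `2 ^ 10 = 32 ^ 2`, the Clifford action is
faithful (`cliffordAction_injective`).

For the Weyl representations, products of two creation or annihilation operators lie in the span of
`Spin(10)`. A nonzero invariant `U` of one parity, together with its images under single operators,
is stable under all of them, hence is everything, and parity gives irreducibility. For
inequivalence, the number operators lie in the span and all kill the vacuum, but no nonzero odd form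
is killed by all of them.

The lift of `SU(5)` is built by hand instead of by a covering argument. A unitary map is a product
of complex reflections, and a complex reflection with eigenvalue `μ ^ 2` is, up to the scalar `conj
μ`, the action of a product of two unit vectors (`cliffordAction_vec_mul_vec`). The scalars multiply
to a square root of the inverse determinant, which is a sign on `SU(5)`, and `-1` is itself in
`Spin(10)`. Faithfulness makes the lift unique, hence a homomorphism; it also lets continuity be
checked on matrix coefficients.

For the fermions, `Λ*ℂ⁵` is the product of the exterior algebras of `ℂ²` and `ℂ³`. Its twelve pieces
`Λᵖℂ² · Λ^qℂ³` are exactly the six particles and six antiparticles, the duals entering by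
contraction of volume forms. The resulting equivariant map is onto, and both sides have dimension
`32`. Compactness of `G_SM / ℤ₆` upgrades the injection into `Spin(10)` to a closed embedding. -/

theorem create_apply (z : Fin 5 → ℂ) (x : Ext5) : create z x = ExteriorAlgebra.ι ℂ z * x := rfl

theorem create_create_self (z : Fin 5 → ℂ) (x : Ext5) : create z (create z x) = 0 := by
  rw [create_apply, create_apply, ← mul_assoc, ExteriorAlgebra.ι_sq_zero, zero_mul]

theorem create_comm (z w : Fin 5 → ℂ) (x : Ext5) :
    create z (create w x) = -create w (create z x) := by
  simp only [create_apply, ← mul_assoc]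
  rw [eq_neg_of_add_eq_zero_left (ExteriorAlgebra.ι_add_mul_swap z w), neg_mul]

theorem annihilate_annihilate_self (z : Fin 5 → ℂ) (x : Ext5) :
    annihilate z (annihilate z x) = 0 :=
  CliffordAlgebra.contractLeft_contractLeft (Q := (0 : QuadraticForm ℂ (Fin 5 → ℂ))) _ x

theorem annihilate_create (z w : Fin 5 → ℂ) (x : Ext5) :
    annihilate z (create w x) = hermFunctional z w • x - create w (annihilate z x) :=
  CliffordAlgebra.contractLeft_ι_mul (Q := (0 : QuadraticForm ℂ (Fin 5 → ℂ))) _ w x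

theorem annihilate_algebraMap (z : Fin 5 → ℂ) (r : ℂ) :
    annihilate z (algebraMap ℂ Ext5 r) = 0 :=
  CliffordAlgebra.contractLeft_algebraMap (Q := (0 : QuadraticForm ℂ (Fin 5 → ℂ))) _ r

theorem hermFunctional_apply (z w : Fin 5 → ℂ) :
    hermFunctional z w = ∑ r, starRingEnd ℂ (z r) * w r := by
  simp [hermFunctional]

theorem create_add (z w : Fin 5 → ℂ) : create (z + w) = create z + create w := by
  ext x; simp [create, add_mul]

theorem create_smul (c : ℂ) (z : Fin 5 → ℂ) : create (c • z) = c • create z := by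
  ext x; simp [create]

theorem hermFunctional_smul (c : ℂ) (z : Fin 5 → ℂ) :
    hermFunctional (c • z) = starRingEnd ℂ c • hermFunctional z := by
  simp [hermFunctional, Finset.smul_sum, smul_smul]

theorem annihilate_smul (c : ℂ) (z : Fin 5 → ℂ) :
    annihilate (c • z) = starRingEnd ℂ c • annihilate z := by
  ext x; simp [annihilate, hermFunctional_smul]

/-- A property of forms that holds for scalars and is preserved by sums and by creation operators
holds for all forms. -/
theorem ext_induction {p : Ext5 → Prop} (scalar : ∀ r : ℂ, p (algebraMap ℂ Ext5 r))
    (add : ∀ x y, p x → p y → p (x + y)) (create : ∀ x z, p x → p (create z x)) (x : Ext5) : p x :=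
  CliffordAlgebra.left_induction (0 : QuadraticForm ℂ (Fin 5 → ℂ)) (P := p) scalar add create x

/-- The `i`-th standard basis vector of `ℂ⁵`. -/
abbrev stdVec (i : Fin 5) : Fin 5 → ℂ := Pi.single i 1

theorem hermFunctional_stdVec (i j : Fin 5) :
    hermFunctional (stdVec i) (stdVec j) = if i = j then 1 else 0 := by
  simp [hermFunctional_apply, Pi.single_apply, eq_comm]

theorem create_eq_sum (z : Fin 5 → ℂ) : create z = ∑ i, z i • create (stdVec i) := by
  ext x
  have h : z = ∑ i, z i • stdVec i := by
    ext j; simp [Pi.single_apply]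
  conv_lhs => rw [h]
  simp [create, Finset.sum_mul]

/-- The projection `1 - n_i`, where `n_i` is the `i`-th number operator. -/
def empty (i : Fin 5) : Module.End ℂ Ext5 := annihilate (stdVec i) * create (stdVec i)

theorem empty_apply (i : Fin 5) (x : Ext5) :
    empty i x = annihilate (stdVec i) (create (stdVec i) x) := rfl

theorem empty_algebraMap (i : Fin 5) (r : ℂ) :
    empty i (algebraMap ℂ Ext5 r) = algebraMap ℂ Ext5 r := by
  rw [empty_apply, annihilate_create, annihilate_algebraMap, hermFunctional_stdVec]
  simp

theorem empty_create_self (i : Fin 5) (x : Ext5) : empty i (create (stdVec i) x) = 0 := by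
  rw [empty_apply, create_create_self, map_zero]

theorem empty_create_of_ne {i j : Fin 5} (h : i ≠ j) (x : Ext5) :
    empty i (create (stdVec j) x) = create (stdVec j) (empty i x) := by
  rw [empty_apply, create_comm, map_neg, annihilate_create, hermFunctional_stdVec, if_neg h,
    empty_apply]
  simp

theorem empty_annihilate_self (i : Fin 5) (x : Ext5) :
    empty i (annihilate (stdVec i) x) = annihilate (stdVec i) x := by
  have h : create (stdVec i) (annihilate (stdVec i) x) =
      x - annihilate (stdVec i) (create (stdVec i) x) := by
    rw [annihilate_create, hermFunctional_stdVec]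
    simp
  rw [empty_apply, h, map_sub, annihilate_annihilate_self, sub_zero]

theorem create_annihilate_add_empty (i : Fin 5) (x : Ext5) :
    create (stdVec i) (annihilate (stdVec i) x) + empty i x = x := by
  rw [empty_apply, annihilate_create, hermFunctional_stdVec]
  simp

/-- The scalar part of a form. -/
abbrev scalarPart : Ext5 →ₐ[ℂ] ℂ := ExteriorAlgebra.algebraMapInv

theorem scalarPart_create (z : Fin 5 → ℂ) (x : Ext5) : scalarPart (create z x) = 0 := by
  rw [create_apply, map_mul]
  simp [ExteriorAlgebra.algebraMapInv]

/-- A creation operator is a combination of the `create (stdVec i)`, and each of these commutes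
outwards past the projections of other index until `empty i` kills it. Only the scalar part
survives. -/
theorem vacuum_projection (x : Ext5) :
    empty 0 (empty 1 (empty 2 (empty 3 (empty 4 x)))) = algebraMap ℂ Ext5 (scalarPart x) := by
  induction x using ext_induction with
  | scalar r =>
    simp only [empty_algebraMap, AlgHom.commutes, Algebra.algebraMap_self, RingHom.id_apply]
  | add x y hx hy => simp only [map_add, hx, hy]
  | create x z _ =>
    rw [scalarPart_create, map_zero, create_eq_sum]
    simp only [LinearMap.sum_apply, LinearMap.smul_apply, map_sum, map_smul]
    refine Finset.sum_eq_zero fun i _ => ?_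
    fin_cases i <;>
    simp [empty_create_self, empty_create_of_ne]

theorem eq_scalar_of_annihilate_eq_zero {x : Ext5}
    (hx : ∀ i, annihilate (stdVec i) x = 0) : x = algebraMap ℂ Ext5 (scalarPart x) := by
  have h : ∀ i, empty i x = x := fun i => by
    have := create_annihilate_add_empty i x
    rwa [hx, map_zero, zero_add] at this
  rw [← vacuum_projection]
  simp only [h]

/-- Strips the factor `empty i` off a product of projections. In `x = e_i ∧ ι_i x + empty i x` the
operator `T` passes through `e_i ∧`, and `ι_i x` again lies in `N` and is fixed by `empty i`, so
both terms vanish under `T`. -/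
theorem eq_zero_of_projection_eq_zero {N : Submodule ℂ Ext5} (i : Fin 5)
    (hA : ∀ x ∈ N, annihilate (stdVec i) x ∈ N) {T : Module.End ℂ Ext5}
    (hT : ∀ x, T (create (stdVec i) x) = create (stdVec i) (T x))
    (h : ∀ x ∈ N, T (empty i x) = 0) : ∀ x ∈ N, T x = 0 := by
  intro x hx
  rw [← create_annihilate_add_empty i x, map_add, h x hx, hT, ← empty_annihilate_self,
    h _ (hA x hx), map_zero, add_zero]

/-- The vacuum projection vanishes on `N`; removing its five factors one at a time leaves the
identity vanishing on `N`. -/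
theorem eq_bot_of_scalarPart_eq_zero {N : Submodule ℂ Ext5}
    (hA : ∀ i, ∀ x ∈ N, annihilate (stdVec i) x ∈ N) (h : ∀ x ∈ N, scalarPart x = 0) : N = ⊥ := by
  have h4 : ∀ x ∈ N, empty 0 (empty 1 (empty 2 (empty 3 (empty 4 x)))) = 0 := fun x hx => by
    rw [vacuum_projection, h x hx, map_zero]
  have h3 := eq_zero_of_projection_eq_zero (T := empty 0 * empty 1 * empty 2 * empty 3) 4 (hA 4)
    (fun x => by simp [empty_create_of_ne]) h4
  have h2 := eq_zero_of_projection_eq_zero (T := empty 0 * empty 1 * empty 2) 3 (hA 3)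
    (fun x => by simp [empty_create_of_ne]) h3
  have h1 := eq_zero_of_projection_eq_zero (T := empty 0 * empty 1) 2 (hA 2)
    (fun x => by simp [empty_create_of_ne]) h2
  have h0 := eq_zero_of_projection_eq_zero (T := empty 0) 1 (hA 1)
    (fun x => by simp [empty_create_of_ne]) h1
  have h' := eq_zero_of_projection_eq_zero (T := 1) 0 (hA 0) (fun x => rfl) h0
  exact (Submodule.eq_bot_iff N).2 h'

theorem eq_top_of_one_mem {N : Submodule ℂ Ext5} (hC : ∀ z, ∀ x ∈ N, create z x ∈ N)
    (h : 1 ∈ N) : N = ⊤ := by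
  refine eq_top_iff.2 fun x _ => ?_
  induction x using ext_induction with
  | scalar r => rw [Algebra.algebraMap_eq_smul_one]; exact N.smul_mem r h
  | add x y hx hy => exact N.add_mem (hx trivial) (hy trivial)
  | create x z hx => exact hC z x (hx trivial)

/-- The exterior algebra is an irreducible module under the creation and annihilation operators. -/
theorem eq_bot_or_eq_top {N : Submodule ℂ Ext5} (hC : ∀ z, ∀ x ∈ N, create z x ∈ N)
    (hA : ∀ z, ∀ x ∈ N, annihilate z x ∈ N) : N = ⊥ ∨ N = ⊤ := by
  by_cases h : ∀ x ∈ N, scalarPart x = 0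
  · exact Or.inl (eq_bot_of_scalarPart_eq_zero (fun i => hA _) h)
  · push Not at h
    obtain ⟨x, hx, hx0⟩ := h
    have hE : ∀ i, ∀ y ∈ N, empty i y ∈ N := fun i y hy => hA _ _ (hC _ _ hy)
    -- The vacuum projection of `x` is a nonzero multiple of `1` and stays in `N`.
    have h1 := hE 0 _ (hE 1 _ (hE 2 _ (hE 3 _ (hE 4 x hx))))
    rw [vacuum_projection, Algebra.algebraMap_eq_smul_one] at h1
    exact Or.inr (eq_top_of_one_mem hC ((N.smul_mem_iff hx0).1 h1))

/-! ### Clifford multiplication in terms of creation and annihilation operators -/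

/-- The real vector corresponding to `z ∈ ℂ⁵`. -/
def toReal (z : Fin 5 → ℂ) : Fin 10 → ℝ := fun k =>
  if (k : ℕ) % 2 = 0 then (z ⟨k / 2, by omega⟩).re else -(z ⟨k / 2, by omega⟩).im

theorem toComplex_toReal (z : Fin 5 → ℂ) : toComplex (toReal z) = z := by
  ext r
  have h : (⟨(2 * (r : ℕ) + 1) / 2, by omega⟩ : Fin 5) = r := Fin.ext (by simp; omega)
  apply Complex.ext <;> simp [toComplex, toReal, Nat.add_mod, h]

/-- The vector of the Clifford algebra corresponding to `z ∈ ℂ⁵`. -/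
def vec (z : Fin 5 → ℂ) : CliffordAlgebra negForm := CliffordAlgebra.ι negForm (toReal z)

theorem cliffordAction_vec (z : Fin 5 → ℂ) :
    cliffordAction (vec z) = create z - annihilate z := by
  rw [vec, cliffordAction, CliffordAlgebra.lift_ι_apply]
  change create (toComplex (toReal z)) - annihilate (toComplex (toReal z)) = _
  rw [toComplex_toReal]

/-- Creation is linear in `z` and annihilation conjugate linear, so combining the actions of `z` and
`i z` separates the two. -/
theorem two_smul_create (z : Fin 5 → ℂ) : (2 : ℂ) • create z =
    cliffordAction (vec z) - Complex.I • cliffordAction (vec (Complex.I • z)) := by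
  simp only [cliffordAction_vec, create_smul, annihilate_smul, Complex.conj_I]
  rw [smul_sub, smul_smul, smul_smul]
  simp
  module

theorem two_smul_annihilate (z : Fin 5 → ℂ) : (2 : ℂ) • annihilate z =
    -cliffordAction (vec z) - Complex.I • cliffordAction (vec (Complex.I • z)) := by
  simp only [cliffordAction_vec, create_smul, annihilate_smul, Complex.conj_I]
  rw [smul_sub, smul_smul, smul_smul]
  simp
  module

theorem create_mem_of_vec_mem {V : Submodule ℂ (Module.End ℂ Ext5)}
    (h : ∀ z, cliffordAction (vec z) ∈ V) (z : Fin 5 → ℂ) : create z ∈ V :=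
  (V.smul_mem_iff (two_ne_zero (α := ℂ))).1 (by
    rw [two_smul_create]; exact sub_mem (h _) (V.smul_mem _ (h _)))

theorem annihilate_mem_of_vec_mem {V : Submodule ℂ (Module.End ℂ Ext5)}
    (h : ∀ z, cliffordAction (vec z) ∈ V) (z : Fin 5 → ℂ) : annihilate z ∈ V :=
  (V.smul_mem_iff (two_ne_zero (α := ℂ))).1 (by
    rw [two_smul_annihilate]; exact sub_mem (neg_mem (h _)) (V.smul_mem _ (h _)))

/-! ### The Clifford action is faithful -/

/-- The standard basis of `Λ*ℂ⁵`. -/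
abbrev extBasis : Module.Basis (Finset (Fin 5)) ℂ Ext5 := (Pi.basisFun ℂ (Fin 5)).ExteriorAlgebra

instance : Module.Finite ℂ Ext5 := Module.Finite.of_basis extBasis

theorem finrank_ext : Module.finrank ℂ Ext5 = 32 := by
  rw [Module.finrank_eq_card_basis extBasis]; simp

/-- The standard basis of the Clifford algebra. -/
def cliffordBasis : Module.Basis (Finset (Fin 10)) ℝ (CliffordAlgebra negForm) :=
  (Pi.basisFun ℝ (Fin 10)).ExteriorAlgebra.map (CliffordAlgebra.equivExterior negForm).symm

instance : Module.Finite ℝ (CliffordAlgebra negForm) := Module.Finite.of_basis cliffordBasis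

/-- The complex span of the image of the Clifford algebra. -/
def cliffordSpan : Submodule ℂ (Module.End ℂ Ext5) := Submodule.span ℂ (Set.range cliffordAction)

theorem cliffordSpan_mul {S T : Module.End ℂ Ext5} (hS : S ∈ cliffordSpan)
    (hT : T ∈ cliffordSpan) : S * T ∈ cliffordSpan := by
  have h := Submodule.mul_mem_mul hS hT
  rw [cliffordSpan, Submodule.span_mul_span] at h
  refine Submodule.span_mono ?_ h
  rintro _ ⟨_, ⟨a, rfl⟩, _, ⟨b, rfl⟩, rfl⟩
  exact ⟨a * b, map_mul _ _ _⟩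

theorem create_mem_cliffordSpan (z : Fin 5 → ℂ) : create z ∈ cliffordSpan :=
  create_mem_of_vec_mem (fun _ => Submodule.subset_span (Set.mem_range_self _)) z

theorem annihilate_mem_cliffordSpan (z : Fin 5 → ℂ) : annihilate z ∈ cliffordSpan :=
  annihilate_mem_of_vec_mem (fun _ => Submodule.subset_span (Set.mem_range_self _)) z

theorem mulLeft_mem_cliffordSpan (y : Ext5) : LinearMap.mulLeft ℂ y ∈ cliffordSpan := by
  induction y using ext_induction with
  | scalar r =>
    have h : LinearMap.mulLeft ℂ (algebraMap ℂ Ext5 r) = r • cliffordAction 1 := by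
      ext x; simp [Algebra.smul_def]
    rw [h]
    exact Submodule.smul_mem _ _ (Submodule.subset_span ⟨_, rfl⟩)
  | add x y hx hy =>
    have h : LinearMap.mulLeft ℂ (x + y) = LinearMap.mulLeft ℂ x + LinearMap.mulLeft ℂ y := by
      ext; simp [add_mul]
    rw [h]
    exact add_mem hx hy
  | create x z hx =>
    rw [create_apply, LinearMap.mulLeft_mul]
    exact cliffordSpan_mul (create_mem_cliffordSpan z) hx

/-- The functionals `f` such that all rank one operators `x ↦ f(x) y` come from the complexified
Clifford algebra. -/
def rankOneFunctionals : Submodule ℂ (Module.Dual ℂ Ext5) where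
  carrier := {f | ∀ y, f.smulRight y ∈ cliffordSpan}
  zero_mem' y := by
    have : (0 : Module.Dual ℂ Ext5).smulRight y = 0 := by ext; simp
    rw [this]; exact zero_mem _
  add_mem' {f g} hf hg y := by
    have : (f + g).smulRight y = f.smulRight y + g.smulRight y := by ext; simp [add_smul]
    rw [this]; exact add_mem (hf y) (hg y)
  smul_mem' c f hf y := by
    have : (c • f).smulRight y = c • f.smulRight y := by ext; simp [smul_smul]
    rw [this]; exact Submodule.smul_mem _ _ (hf y)

theorem comp_mem_rankOneFunctionals {f : Module.Dual ℂ Ext5} (hf : f ∈ rankOneFunctionals)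
    {T : Module.End ℂ Ext5} (hT : T ∈ cliffordSpan) : f ∘ₗ T ∈ rankOneFunctionals := fun y =>
  cliffordSpan_mul (hf y) hT

/-- The operator `x ↦ scalarPart x • y` is the vacuum projection followed by multiplication by `y`.
-/
theorem scalarPart_mem_rankOneFunctionals : scalarPart.toLinearMap ∈ rankOneFunctionals := by
  intro y
  have hE : ∀ i, empty i ∈ cliffordSpan := fun i =>
    cliffordSpan_mul (annihilate_mem_cliffordSpan _) (create_mem_cliffordSpan _)
  have h : scalarPart.toLinearMap.smulRight y = LinearMap.mulLeft ℂ y *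
      (empty 0 * (empty 1 * (empty 2 * (empty 3 * empty 4)))) := by
    apply LinearMap.ext
    intro x
    have := vacuum_projection x
    change scalarPart x • y = y * empty 0 (empty 1 (empty 2 (empty 3 (empty 4 x))))
    rw [this, Algebra.algebraMap_eq_smul_one, mul_smul_comm, mul_one]
  rw [h]
  exact cliffordSpan_mul (mulLeft_mem_cliffordSpan y) (cliffordSpan_mul (hE _)
    (cliffordSpan_mul (hE _) (cliffordSpan_mul (hE _) (cliffordSpan_mul (hE _) (hE _)))))

/-- These functionals are closed under precomposition with annihilation operators and include the
scalar part. Their common kernel is therefore stable under annihilation and has no scalar part, so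
it is zero; in finite dimension a space of functionals with zero common kernel is the whole dual. -/
theorem rankOneFunctionals_eq_top : rankOneFunctionals = ⊤ := by
  have h : rankOneFunctionals.dualCoannihilator = ⊥ := by
    refine eq_bot_of_scalarPart_eq_zero ?_ ?_
    · intro i x hx
      rw [Submodule.mem_dualCoannihilator] at hx ⊢
      exact fun f hf => hx _ (comp_mem_rankOneFunctionals hf (annihilate_mem_cliffordSpan _))
    · intro x hx
      exact (Submodule.mem_dualCoannihilator x).1 hx _ scalarPart_mem_rankOneFunctionals
  rw [← Subspace.dualCoannihilator_dualAnnihilator_eq (W := rankOneFunctionals), h,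
    Submodule.dualAnnihilator_bot]

theorem cliffordSpan_eq_top : cliffordSpan = ⊤ := by
  refine eq_top_iff.2 fun T _ => ?_
  have h : T = ∑ s, (extBasis.coord s).smulRight (T (extBasis s)) := by
    refine extBasis.ext fun t => ?_
    simp [Finsupp.single_apply]
  rw [h]
  refine sum_mem fun s _ => ?_
  have : extBasis.coord s ∈ rankOneFunctionals := by rw [rankOneFunctionals_eq_top]; trivial
  exact this _

/-- The images of the `2 ^ 10` basis elements span a complex space of dimension `32 ^ 2`, so they
are linearly independent over `ℂ`, and in particular over `ℝ`. -/
theorem cliffordAction_injective : Function.Injective cliffordAction := by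
  have hspan : ⊤ ≤ Submodule.span ℂ (Set.range fun s => cliffordAction (cliffordBasis s)) := by
    rw [← cliffordSpan_eq_top, cliffordSpan, Submodule.span_le]
    rintro _ ⟨a, rfl⟩
    rw [← cliffordBasis.sum_repr a, map_sum]
    refine sum_mem fun s _ => ?_
    rw [map_smul]
    exact Submodule.smul_mem _ ((cliffordBasis.repr a s : ℝ) : ℂ) (Submodule.subset_span ⟨s, rfl⟩)
  have hind := linearIndependent_of_top_le_span_of_card_eq_finrank hspan (by
    rw [Module.finrank_linearMap, finrank_ext]; simp)
  rw [Fintype.linearIndependent_iff] at hind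
  refine (injective_iff_map_eq_zero _).2 fun a ha => ?_
  have h := hind (fun s => ((cliffordBasis.repr a s : ℝ) : ℂ)) (by
    rw [← ha]
    conv_rhs => rw [← cliffordBasis.sum_repr a, map_sum]
    refine Finset.sum_congr rfl fun s _ => ?_
    rw [map_smul]
    rfl)
  rw [← cliffordBasis.sum_repr a]
  refine Finset.sum_eq_zero fun s _ => ?_
  rw [Complex.ofReal_eq_zero.1 (h s), zero_smul]

/-! ### Products of unit vectors in `Spin(10)` -/

theorem hermFunctional_self (z : Fin 5 → ℂ) :
    hermFunctional z z = ((∑ r, Complex.normSq (z r) : ℝ) : ℂ) := by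
  rw [hermFunctional_apply, Complex.ofReal_sum]
  exact Finset.sum_congr rfl fun r _ => (Complex.normSq_eq_conj_mul_self).symm

theorem hermFunctional_toComplex_self (v : Fin 10 → ℝ) :
    hermFunctional (toComplex v) (toComplex v) = ((-negForm v : ℝ) : ℂ) := by
  simp [hermFunctional, toComplex, negForm, QuadraticMap.weightedSumSquares_apply,
    Fin.sum_univ_succ]
  ring_nf
  simp
  ring

theorem vec_mul_self {z : Fin 5 → ℂ} (hz : hermFunctional z z = 1) : vec z * vec z = -1 := by
  have h := hermFunctional_toComplex_self (toReal z)
  rw [toComplex_toReal, hz, eq_comm, Complex.ofReal_eq_one, neg_eq_iff_eq_neg] at h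
  rw [vec, CliffordAlgebra.ι_sq_scalar, h, map_neg, map_one]

theorem vec_mem_pinGroup {z : Fin 5 → ℂ} (hz : hermFunctional z z = 1) :
    vec z ∈ pinGroup negForm := by
  have h := vec_mul_self hz
  have hs : star (vec z) = -vec z := CliffordAlgebra.star_ι _
  refine ⟨⟨⟨vec z, -vec z, by rw [mul_neg, h, neg_neg], by rw [neg_mul, h, neg_neg]⟩,
    Subgroup.subset_closure ⟨_, rfl⟩, rfl⟩, ?_, ?_⟩
  · rw [hs, neg_mul, h, neg_neg]
  · rw [hs, mul_neg, h, neg_neg]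

theorem vec_mul_vec_mem_spinGroup {z w : Fin 5 → ℂ} (hz : hermFunctional z z = 1)
    (hw : hermFunctional w w = 1) : vec z * vec w ∈ spinGroup negForm :=
  ⟨mul_mem (vec_mem_pinGroup hz) (vec_mem_pinGroup hw),
    CliffordAlgebra.ι_mul_ι_mem_evenOdd_zero negForm _ _⟩

theorem vec_smul (r : ℝ) (z : Fin 5 → ℂ) : vec ((r : ℂ) • z) = r • vec z := by
  rw [vec, vec, ← map_smul]
  congr 1
  ext k
  simp only [toReal, Pi.smul_apply, smul_eq_mul, Complex.re_ofReal_mul, Complex.im_ofReal_mul]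
  split_ifs <;> ring

theorem exists_smul_unit {z : Fin 5 → ℂ} (hz : z ≠ 0) :
    ∃ (r : ℝ) (u : Fin 5 → ℂ), 0 < r ∧ hermFunctional u u = 1 ∧ z = (r : ℂ) • u := by
  have hpos : 0 < ∑ r, Complex.normSq (z r) := by
    obtain ⟨i, hi⟩ := Function.ne_iff.1 hz
    exact Finset.sum_pos' (fun _ _ => Complex.normSq_nonneg _)
      ⟨i, Finset.mem_univ i, Complex.normSq_pos.2 hi⟩
  set s := Real.sqrt (∑ r, Complex.normSq (z r)) with hs
  have hs0 : 0 < s := Real.sqrt_pos.2 hpos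
  have hs2 : s * s = ∑ r, Complex.normSq (z r) := Real.mul_self_sqrt hpos.le
  have hc : (s : ℂ) ≠ 0 := Complex.ofReal_ne_zero.2 hs0.ne'
  refine ⟨s, (s : ℂ)⁻¹ • z, hs0, ?_, ?_⟩
  · rw [hermFunctional_smul, LinearMap.smul_apply, map_smul, hermFunctional_self, ← hs2]
    simp
    field_simp
  · rw [smul_smul, mul_inv_cancel₀ hc, one_smul]

/-! ### The Weyl spinor representations -/

/-- The complex span of the operators of the Dirac spinor representation. -/
def spinSpan : Submodule ℂ (Module.End ℂ Ext5) := Submodule.span ℂ (Set.range diracRep)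

/-- Products of two unit vectors are in `Spin(10)`; other nonzero vectors are rescaled to unit ones.
-/
theorem vec_mul_vec_mem_spinSpan (z w : Fin 5 → ℂ) :
    cliffordAction (vec z) * cliffordAction (vec w) ∈ spinSpan := by
  have h0 : vec 0 = 0 := by simpa using vec_smul 0 0
  by_cases hz : z = 0
  · rw [hz, h0, map_zero, zero_mul]; exact zero_mem _
  by_cases hw : w = 0
  · rw [hw, h0, map_zero, mul_zero]; exact zero_mem _
  obtain ⟨r, u, -, hu, rfl⟩ := exists_smul_unit hz
  obtain ⟨s, v, -, hv, rfl⟩ := exists_smul_unit hw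
  rw [vec_smul, vec_smul, map_smul, map_smul, smul_mul_smul_comm, ← map_mul]
  exact Submodule.smul_mem _ ((r * s : ℝ) : ℂ)
    (Submodule.subset_span ⟨⟨_, vec_mul_vec_mem_spinGroup hu hv⟩, rfl⟩)

/-- The span of the creation and annihilation operators. -/
def fieldSpan : Submodule ℂ (Module.End ℂ Ext5) :=
  Submodule.span ℂ (Set.range fun z => cliffordAction (vec z))

theorem create_mem_fieldSpan (z : Fin 5 → ℂ) : create z ∈ fieldSpan :=
  create_mem_of_vec_mem (V := fieldSpan) (fun _ => Submodule.subset_span (Set.mem_range_self _)) z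

theorem annihilate_mem_fieldSpan (z : Fin 5 → ℂ) : annihilate z ∈ fieldSpan :=
  annihilate_mem_of_vec_mem (V := fieldSpan)
    (fun _ => Submodule.subset_span (Set.mem_range_self _)) z

theorem field_mul_mem_spinSpan {S T : Module.End ℂ Ext5} (hS : S ∈ fieldSpan)
    (hT : T ∈ fieldSpan) : S * T ∈ spinSpan := by
  have h := Submodule.mul_mem_mul hS hT
  rw [fieldSpan, Submodule.span_mul_span] at h
  refine (Submodule.span_le.2 ?_) h
  rintro _ ⟨_, ⟨z, rfl⟩, _, ⟨w, rfl⟩, rfl⟩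
  exact vec_mul_vec_mem_spinSpan z w

theorem spinSpan_apply_mem {U : Submodule ℂ Ext5} (hU : ∀ g, ∀ x ∈ U, diracRep g x ∈ U)
    {T : Module.End ℂ Ext5} (hT : T ∈ spinSpan) {x : Ext5} (hx : x ∈ U) : T x ∈ U := by
  induction hT using Submodule.span_induction with
  | mem T hT => obtain ⟨g, rfl⟩ := hT; exact hU g x hx
  | zero => exact zero_mem _
  | add S T _ _ hS hT => exact add_mem hS hT
  | smul c T _ hT => exact Submodule.smul_mem _ c hT

theorem field_apply_mem_extParity {T : Module.End ℂ Ext5} (hT : T ∈ fieldSpan) {i : ZMod 2}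
    {x : Ext5} (hx : x ∈ extParity i) : T x ∈ extParity (i + 1) := by
  induction hT using Submodule.span_induction with
  | mem T hT =>
    obtain ⟨z, rfl⟩ := hT
    change cliffordAction (vec z) x ∈ _
    rw [cliffordAction_vec]
    exact sub_mem (create_mem z hx) (annihilate_mem z hx)
  | zero => exact zero_mem _
  | add S T _ _ hS hT => exact add_mem hS hT
  | smul c T _ hT => exact Submodule.smul_mem _ c hT

theorem isCompl_extParity : IsCompl (extParity 0) (extParity 1) :=
  CliffordAlgebra.evenOdd_isCompl (0 : QuadraticForm ℂ (Fin 5 → ℂ))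

theorem isCompl_extParity_add_one (i : ZMod 2) : IsCompl (extParity i) (extParity (i + 1)) := by
  have hi : i = 0 ∨ i = 1 := by revert i; decide
  obtain rfl | rfl := hi
  · exact isCompl_extParity
  · exact isCompl_extParity.symm

/-- Let `V` be the span of the images of `U` under single field operators. Products of two such
operators preserve `U`, so they send `V` back into `U`, and `U ⊔ V` is stable under all creation and
annihilation operators. It is thus everything; as `U` and `V` have opposite parity, `U` is a full
parity part. -/
theorem eq_extParity_of_invariant {i : ZMod 2} {U : Submodule ℂ Ext5} (hi : U ≤ extParity i)
    (hU : ∀ g, ∀ x ∈ U, diracRep g x ∈ U) (h0 : U ≠ ⊥) : U = extParity i := by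
  let V : Submodule ℂ Ext5 := Submodule.span ℂ {y | ∃ T ∈ fieldSpan, ∃ x ∈ U, T x = y}
  have hV : V ≤ extParity (i + 1) := Submodule.span_le.2 (by
    rintro _ ⟨T, hT, x, hx, rfl⟩
    exact field_apply_mem_extParity hT (hi hx))
  have hVU : ∀ T ∈ fieldSpan, ∀ y ∈ V, T y ∈ U := by
    intro T hT y hy
    induction hy using Submodule.span_induction with
    | mem y hy =>
      obtain ⟨S, hS, x, hx, rfl⟩ := hy
      exact spinSpan_apply_mem hU (field_mul_mem_spinSpan hT hS) hx
    | zero => rw [map_zero]; exact zero_mem _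
    | add x y _ _ hx hy => rw [map_add]; exact add_mem hx hy
    | smul c x _ hx => rw [map_smul]; exact Submodule.smul_mem _ c hx
  have hUV : ∀ T ∈ fieldSpan, ∀ y ∈ U ⊔ V, T y ∈ U ⊔ V := by
    intro T hT y hy
    obtain ⟨u, hu, v, hv, rfl⟩ := Submodule.mem_sup.1 hy
    rw [map_add]
    exact add_mem (Submodule.mem_sup_right (Submodule.subset_span ⟨T, hT, u, hu, rfl⟩))
      (Submodule.mem_sup_left (hVU T hT v hv))
  have htop : U ⊔ V = ⊤ := (eq_bot_or_eq_top (fun z => hUV _ (create_mem_fieldSpan z))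
    (fun z => hUV _ (annihilate_mem_fieldSpan z))).resolve_left fun h =>
      h0 (le_bot_iff.1 (h ▸ le_sup_left))
  refine le_antisymm hi fun x hx => ?_
  have hx' : x ∈ U ⊔ V := by rw [htop]; trivial
  obtain ⟨u, hu, v, hv, rfl⟩ := Submodule.mem_sup.1 hx'
  have hv' : v ∈ extParity i := by
    have := sub_mem hx (hi hu)
    rwa [add_sub_cancel_left] at this
  -- The remainder `v` has both parities.
  have hv0 : v = 0 :=
    (Submodule.disjoint_def.1 (isCompl_extParity_add_one i).disjoint) v hv' (hV hv)
  rwa [hv0, add_zero]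

theorem one_mem_extParity : (1 : Ext5) ∈ extParity 0 :=
  SetLike.one_mem_graded (CliffordAlgebra.evenOdd (0 : QuadraticForm ℂ (Fin 5 → ℂ)))

theorem extParity_ne_bot (i : ZMod 2) : extParity i ≠ ⊥ := by
  have hi : i = 0 ∨ i = 1 := by revert i; decide
  obtain rfl | rfl := hi
  · exact fun h => one_ne_zero ((Submodule.eq_bot_iff _).1 h 1 one_mem_extParity)
  · intro h
    have h1 : create (stdVec 0) 1 ∈ extParity (0 + 1) := create_mem _ one_mem_extParity
    rw [zero_add, h, Submodule.mem_bot] at h1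
    rw [create_apply, mul_one, ExteriorAlgebra.ι_eq_zero_iff] at h1
    simpa using congrFun h1 0

theorem weyl_isIrreducible (i : ZMod 2) : (weyl i).toRepresentation.IsIrreducible where
  exists_pair_ne := ⟨⊥, ⊤, fun h => extParity_ne_bot i (by
    have h' : (⊥ : Submodule ℂ (weyl i).toSubmodule) = ⊤ :=
      congrArg Subrepresentation.toSubmodule h
    rw [eq_comm, Submodule.eq_bot_iff] at h'
    exact (Submodule.eq_bot_iff _).2 fun x hx =>
      congrArg Subtype.val (h' ⟨x, hx⟩ Submodule.mem_top))⟩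
  eq_bot_or_eq_top W := by
    refine or_iff_not_imp_left.2 fun hW => ?_
    have h := eq_extParity_of_invariant (i := i)
      (U := W.toSubmodule.map (weyl i).toSubmodule.subtype)
      (Submodule.map_subtype_le _ _) ?_ ?_
    · refine Subrepresentation.toSubmodule_injective (eq_top_iff.2 fun x _ => ?_)
      have hx : (x : Ext5) ∈ W.toSubmodule.map (weyl i).toSubmodule.subtype := h ▸ x.2
      obtain ⟨y, hy, hyx⟩ := hx
      rwa [← Subtype.ext hyx]
    · rintro g _ ⟨x, hx, rfl⟩
      exact ⟨_, W.apply_mem_toSubmodule g hx, rfl⟩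
    · refine fun h => hW (Subrepresentation.toSubmodule_injective ?_)
      exact Submodule.map_injective_of_injective (Submodule.subtype_injective _)
        (h.trans (Submodule.map_bot _).symm)

/-- Intertwining is a linear condition on the operator, so it extends from group elements to their
complex span. The vector `y` records that `T x` stays in the given parity, where `f` is defined. -/
theorem intertwiner_spinSpan {i j : ZMod 2} (f : extParity i →ₗ[ℂ] extParity j)
    (hf : ∀ g x, f ((weyl i).toRepresentation g x) = (weyl j).toRepresentation g (f x))
    {T : Module.End ℂ Ext5} (hT : T ∈ spinSpan) (x : extParity i) :
    ∃ y : extParity i, (y : Ext5) = T x ∧ (f y : Ext5) = T (f x) := by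
  induction hT using Submodule.span_induction with
  | mem T hT =>
    obtain ⟨g, rfl⟩ := hT
    exact ⟨(weyl i).toRepresentation g x, rfl, congrArg Subtype.val (hf g x)⟩
  | zero => exact ⟨0, rfl, by rw [map_zero]; rfl⟩
  | add S T _ _ hS hT =>
    obtain ⟨y, hy, hfy⟩ := hS
    obtain ⟨z, hz, hfz⟩ := hT
    exact ⟨y + z, by simp [hy, hz], by simp [hfy, hfz]⟩
  | smul c T _ hT =>
    obtain ⟨y, hy, hfy⟩ := hT
    exact ⟨c • y, by simp [hy], by simp [hfy]⟩

/-- The number operators `e_i ∧ ι_i` are in the span of `Spin(10)` and kill the vacuum, so they kill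
its image. A form killed by all of them is a scalar, hence even, while the image is odd. -/
theorem intertwiner_one (f : extParity 0 →ₗ[ℂ] extParity 1)
    (hf : ∀ g x, f ((weyl 0).toRepresentation g x) = (weyl 1).toRepresentation g (f x)) :
    f ⟨1, one_mem_extParity⟩ = 0 := by
  set v : extParity 0 := ⟨1, one_mem_extParity⟩ with hv
  have hn : ∀ i, create (stdVec i) (annihilate (stdVec i) (f v : Ext5)) = 0 := by
    intro i
    obtain ⟨y, hy, hfy⟩ := intertwiner_spinSpan f hf (field_mul_mem_spinSpan
      (create_mem_fieldSpan (stdVec i)) (annihilate_mem_fieldSpan (stdVec i))) v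
    have hy0 : y = 0 := Subtype.ext (hy.trans (by
      have h1 : annihilate (stdVec i) 1 = 0 := by
        rw [← map_one (algebraMap ℂ Ext5), annihilate_algebraMap]
      rw [Module.End.mul_apply, hv, h1, map_zero]
      rfl))
    rw [hy0, map_zero] at hfy
    exact hfy.symm
  have ha : ∀ i, annihilate (stdVec i) (f v : Ext5) = 0 := fun i => by
    rw [← empty_annihilate_self, empty_apply, hn, map_zero]
  have hs : (f v : Ext5) ∈ extParity 0 := by
    rw [eq_scalar_of_annihilate_eq_zero ha, Algebra.algebraMap_eq_smul_one]
    exact Submodule.smul_mem _ _ one_mem_extParity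
  exact Subtype.ext (Submodule.disjoint_def.1 isCompl_extParity.disjoint _ hs (f v).2)

theorem deltaPlus_not_equiv_deltaMinus :
    IsEmpty (deltaPlus.toRepresentation.Equiv deltaMinus.toRepresentation) := by
  refine ⟨fun f => ?_⟩
  have h := intertwiner_one f.toLinearEquiv.toLinearMap
    (fun g x => LinearMap.congr_fun (f.isIntertwining' g) x)
  have hv := (LinearEquiv.map_eq_zero_iff f.toLinearEquiv).1 h
  exact one_ne_zero (congrArg Subtype.val hv)

/-! ### Lifting unitary maps to the spin group -/

/-- The complex reflection `m ↦ m + s ⟨w, m⟩ w`. -/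
def reflection (s : ℂ) (w : Fin 5 → ℂ) : Module.End ℂ (Fin 5 → ℂ) :=
  LinearMap.transvection (s • hermFunctional w) w

theorem reflection_apply (s : ℂ) (w m : Fin 5 → ℂ) :
    reflection s w m = m + (s * hermFunctional w m) • w := rfl

theorem det_reflection (s : ℂ) (w : Fin 5 → ℂ) :
    LinearMap.det (reflection s w) = 1 + s * hermFunctional w w :=
  LinearMap.transvection.det _ _

/-- The right side is multiplicative under wedging with `z`: the term quadratic in `s` contains `w ∧
w = 0`, and the other terms match by the anticommutation relations. -/
theorem map_reflection (s : ℂ) (w : Fin 5 → ℂ) (x : Ext5) :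
    ExteriorAlgebra.map (reflection s w) x = x + s • create w (annihilate w x) := by
  induction x using ext_induction with
  | scalar r => rw [AlgHom.commutes, annihilate_algebraMap, map_zero, smul_zero, add_zero]
  | add x y hx hy => simp only [map_add, hx, hy, smul_add]; abel
  | create x z hx =>
    have h1 : ExteriorAlgebra.map (reflection s w) (create z x) =
        create (reflection s w z) (x + s • create w (annihilate w x)) := by
      rw [create_apply, map_mul, ExteriorAlgebra.map_apply_ι, hx]; rfl
    rw [h1, reflection_apply, create_add, create_smul, annihilate_create, map_sub, create_comm w z]
    simp only [LinearMap.add_apply, LinearMap.smul_apply, map_add, map_smul, create_create_self]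
    module

/-- The product acts as `μ (w ∧ ι_w) + conj μ (ι_w w ∧)`: it is `conj μ` on forms killed by `ι_w`
and `μ` on multiples of `w`. This is `conj μ` times the extension of the reflection with eigenvalue
`μ ^ 2` on `w`. -/
theorem cliffordAction_vec_mul_vec {w : Fin 5 → ℂ} (hw : hermFunctional w w = 1) {μ : ℂ}
    (hμ : starRingEnd ℂ μ * μ = 1) :
    cliffordAction (vec w * vec (-starRingEnd ℂ μ • w)) =
      starRingEnd ℂ μ • (ExteriorAlgebra.map (reflection (μ ^ 2 - 1) w)).toLinearMap := by
  refine LinearMap.ext fun x => ?_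
  rw [map_mul, cliffordAction_vec, cliffordAction_vec, create_smul, annihilate_smul]
  have h : annihilate w (create w x) = x - create w (annihilate w x) := by
    rw [annihilate_create, hw, one_smul]
  have h2 : starRingEnd ℂ μ * (μ ^ 2 - 1) = μ - starRingEnd ℂ μ := by linear_combination μ * hμ
  simp only [Module.End.mul_apply, LinearMap.sub_apply, LinearMap.smul_apply, map_sub, map_smul,
    create_create_self, annihilate_annihilate_self, h, AlgHom.toLinearMap_apply, map_reflection,
    smul_add, smul_smul, h2, map_neg, Complex.conj_conj]
  module

/-- The linear map `f` of `ℂ⁵` lifts to `Spin(10)` up to a square root of the inverse of its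
determinant. -/
def LiftsToSpin (f : Module.End ℂ (Fin 5 → ℂ)) : Prop :=
  ∃ x ∈ spinGroup negForm, ∃ c : ℂ, c ^ 2 * LinearMap.det f = 1 ∧
    cliffordAction x = c • (ExteriorAlgebra.map f).toLinearMap

theorem LiftsToSpin.one : LiftsToSpin 1 := by
  refine ⟨1, one_mem _, 1, by simp, ?_⟩
  rw [map_one, one_smul]
  exact (congrArg AlgHom.toLinearMap ExteriorAlgebra.map_id).symm

theorem LiftsToSpin.mul {f g : Module.End ℂ (Fin 5 → ℂ)} (hf : LiftsToSpin f)
    (hg : LiftsToSpin g) : LiftsToSpin (f * g) := by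
  obtain ⟨x, hx, c, hc, hxc⟩ := hf
  obtain ⟨y, hy, d, hd, hyd⟩ := hg
  refine ⟨x * y, mul_mem hx hy, c * d, ?_, ?_⟩
  · rw [map_mul]
    linear_combination (d ^ 2 * LinearMap.det g) * hc + hd
  · rw [map_mul, hxc, hyd, smul_mul_smul_comm]
    congr 1
    exact congrArg AlgHom.toLinearMap (ExteriorAlgebra.map_comp_map _ _)

theorem LiftsToSpin.reflection {w : Fin 5 → ℂ} (hw : hermFunctional w w = 1) {l : ℂ}
    (hl : starRingEnd ℂ l * l = 1) : LiftsToSpin (reflection (l - 1) w) := by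
  -- The choice of square root of `l` is the sign ambiguity of the lift.
  obtain ⟨μ, rfl⟩ := IsAlgClosed.exists_pow_nat_eq l (n := 2) (by norm_num)
  have hμ : starRingEnd ℂ μ * μ = 1 := by
    rw [← Complex.normSq_eq_conj_mul_self, Complex.ofReal_eq_one] at hl ⊢
    rw [map_pow] at hl
    exact (pow_eq_one_iff_of_nonneg (Complex.normSq_nonneg _) two_ne_zero).1 hl
  refine ⟨_, vec_mul_vec_mem_spinGroup hw ?_, _, ?_, cliffordAction_vec_mul_vec hw hμ⟩
  · rw [hermFunctional_smul, LinearMap.smul_apply, map_smul, hw]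
    simp [hμ, mul_comm μ]
  · rw [det_reflection, hw]
    linear_combination (starRingEnd ℂ μ * μ + 1) * hμ

theorem hermFunctional_conj (z w : Fin 5 → ℂ) :
    starRingEnd ℂ (hermFunctional z w) = hermFunctional w z := by
  simp [hermFunctional_apply, mul_comm]

theorem hermFunctional_add (z w : Fin 5 → ℂ) :
    hermFunctional (z + w) = hermFunctional z + hermFunctional w := by
  simp [hermFunctional, add_smul, Finset.sum_add_distrib]

theorem hermFunctional_sub (z w : Fin 5 → ℂ) :
    hermFunctional (z - w) = hermFunctional z - hermFunctional w := by
  simp [hermFunctional, sub_smul, Finset.sum_sub_distrib]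

theorem hermFunctional_reflection {w : Fin 5 → ℂ} (hw : hermFunctional w w = 1) {l : ℂ}
    (hl : starRingEnd ℂ l * l = 1) (x y : Fin 5 → ℂ) :
    hermFunctional (reflection (l - 1) w x) (reflection (l - 1) w y) = hermFunctional x y := by
  simp only [reflection_apply, hermFunctional_add, hermFunctional_smul, LinearMap.add_apply,
    LinearMap.smul_apply, map_add, map_smul, map_mul, map_sub, map_one, hermFunctional_conj, hw,
    smul_eq_mul]
  linear_combination hermFunctional x w * hermFunctional w y * hl

theorem reflection_mul_reflection {w : Fin 5 → ℂ} (hw : hermFunctional w w = 1) {l : ℂ}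
    (hl : starRingEnd ℂ l * l = 1) :
    reflection (starRingEnd ℂ l - 1) w * reflection (l - 1) w = 1 := by
  refine LinearMap.ext fun x => ?_
  simp only [Module.End.mul_apply, reflection_apply, map_add, map_smul, hw,
    Module.End.one_apply]
  have h : (starRingEnd ℂ l - 1) * hermFunctional w x +
      (l - 1) * hermFunctional w x * (1 + (starRingEnd ℂ l - 1) * 1) = 0 := by
    linear_combination hermFunctional w x * hl
  have h2 := congrArg (fun c : ℂ => x + c • w) h
  simp only [zero_smul, add_zero] at h2
  refine Eq.trans ?_ h2
  module

/-- Two distinct vectors of the same length are exchanged by a complex reflection. -/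
theorem exists_reflection {a b : Fin 5 → ℂ} (hab : a ≠ b)
    (h : hermFunctional a a = hermFunctional b b) :
    ∃ (w : Fin 5 → ℂ) (l : ℂ), hermFunctional w w = 1 ∧ starRingEnd ℂ l * l = 1 ∧
      reflection (l - 1) w a = b ∧ ∃ r : ℂ, w = r • (a - b) := by
  obtain ⟨r, w, hr, hw, hrw⟩ := exists_smul_unit (sub_ne_zero.2 hab)
  have hr' : (r : ℂ) ≠ 0 := Complex.ofReal_ne_zero.2 hr.ne'
  set k := hermFunctional w a with hk
  have hba : b = a - (r : ℂ) • w := by rw [← hrw]; abel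
  -- Equality of the lengths of `a` and `a - r w` says that twice the real part of `⟨w, a⟩` is `r`.
  have hkr : k + starRingEnd ℂ k = r := by
    rw [hba] at h
    simp only [hermFunctional_sub, hermFunctional_smul, LinearMap.sub_apply, LinearMap.smul_apply,
      map_sub, map_smul, smul_eq_mul, hw, Complex.conj_ofReal, ← hk] at h
    rw [← hermFunctional_conj w a, ← hk] at h
    exact mul_left_cancel₀ hr' (by linear_combination h)
  have hk0 : k ≠ 0 := fun h0 => hr' (by rw [← hkr, h0]; simp)
  have hk0' : starRingEnd ℂ k ≠ 0 := (map_ne_zero _).2 hk0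
  -- Solves `(l - 1) k = -r` with `r = k + conj k`.
  refine ⟨w, -starRingEnd ℂ k / k, hw, ?_, ?_, (r : ℂ)⁻¹, ?_⟩
  · simp
    field_simp
  · rw [reflection_apply, hba, sub_eq_add_neg a, ← neg_smul, ← hk]
    congr 2
    rw [← hkr]
    field_simp
    ring
  · rw [hrw, smul_smul, inv_mul_cancel₀ hr', one_smul]

/-- A unitary Cartan–Dieudonné argument. A reflection along `f e_n - e_n` moves `f e_n` back to
`e_n` and keeps the later basis vectors fixed, so the induction applies to its composite with `f`.
-/
theorem liftsToSpin_of_fixes (n : ℕ) : ∀ f : Module.End ℂ (Fin 5 → ℂ),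
    (∀ x y, hermFunctional (f x) (f y) = hermFunctional x y) →
    (∀ i : Fin 5, n ≤ i → f (stdVec i) = stdVec i) → LiftsToSpin f := by
  induction n with
  | zero =>
    intro f _ hfix
    have : f = 1 := (Pi.basisFun ℂ (Fin 5)).ext fun i => by simpa using hfix i (Nat.zero_le _)
    rw [this]
    exact LiftsToSpin.one
  | succ n ih =>
    intro f hf hfix
    -- For `n ≥ 5` there is no such index and the first case applies.
    by_cases hn : ∀ i : Fin 5, n = i → f (stdVec i) = stdVec i
    · exact ih f hf fun i hi => (Nat.eq_or_lt_of_le hi).elim (hn i) (hfix i)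
    · push Not at hn
      obtain ⟨k, hk, hne⟩ := hn
      obtain ⟨w, l, hw, hl, hR, r, hr⟩ := exists_reflection hne (hf _ _)
      have hl' : starRingEnd ℂ (starRingEnd ℂ l) * starRingEnd ℂ l = 1 := by
        rw [Complex.conj_conj, mul_comm, hl]
      have h : LiftsToSpin (SpinGUT.reflection (l - 1) w * f) := by
        refine ih _ (fun x y => ?_) fun i hi => ?_
        · rw [Module.End.mul_apply, Module.End.mul_apply, hermFunctional_reflection hw hl, hf]
        · rw [Module.End.mul_apply]
          rcases Nat.eq_or_lt_of_le hi with h | h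
          · rw [show i = k from Fin.ext (h.symm.trans hk), hR]
          · have hik : k ≠ i := fun e => by omega
            rw [hfix i h, reflection_apply]
            -- Since `f` fixes `e_i` and is unitary, `⟨f e_k, e_i⟩ = ⟨f e_k, f e_i⟩ = ⟨e_k, e_i⟩`.
            have : hermFunctional w (stdVec i) = 0 := by
              rw [hr, hermFunctional_smul, hermFunctional_sub, LinearMap.smul_apply,
                LinearMap.sub_apply]
              nth_rewrite 1 [← hfix i h]
              rw [hf, sub_self, smul_zero]
            rw [this, mul_zero, zero_smul, add_zero]
      -- The reflection with the conjugate eigenvalue is the inverse, which recovers `f`.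
      have h2 := (LiftsToSpin.reflection hw hl').mul h
      rwa [← mul_assoc, reflection_mul_reflection hw hl, one_mul] at h2

theorem liftsToSpin_of_unitary {f : Module.End ℂ (Fin 5 → ℂ)}
    (hf : ∀ x y, hermFunctional (f x) (f y) = hermFunctional x y) : LiftsToSpin f :=
  liftsToSpin_of_fixes 5 f hf fun i hi => by omega

theorem hermFunctional_eq_dotProduct (z w : Fin 5 → ℂ) :
    hermFunctional z w = star z ⬝ᵥ w := by
  rw [hermFunctional_apply]; rfl

theorem hermFunctional_fundamental (A : SU 5) (x y : Fin 5 → ℂ) :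
    hermFunctional (fundamental 5 A x) (fundamental 5 A y) = hermFunctional x y := by
  have hA : star (A : Matrix (Fin 5) (Fin 5) ℂ) * A = 1 :=
    Matrix.mem_unitaryGroup_iff'.1 (Matrix.mem_specialUnitaryGroup_iff.1 A.2).1
  simp only [hermFunctional_eq_dotProduct, fundamental, MonoidHom.coe_mk, OneHom.coe_mk,
    Matrix.toLin'_apply]
  rw [Matrix.star_mulVec, Matrix.dotProduct_mulVec, Matrix.vecMul_vecMul,
    ← Matrix.star_eq_conjTranspose, hA, Matrix.vecMul_one]

/-- Determinant one forces `c = ±1`. The sign `-1` is corrected by the element `-1` of `Spin(10)`,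
the square of a unit vector. -/
theorem exists_spin_lift (A : SU 5) : ∃ x : Spin10, diracRep x = exteriorRep A := by
  obtain ⟨x, hx, c, hc, hxc⟩ := liftsToSpin_of_unitary (hermFunctional_fundamental A)
  have hdet : LinearMap.det (fundamental 5 A) = 1 :=
    (LinearMap.det_toLin' _).trans (Matrix.mem_specialUnitaryGroup_iff.1 A.2).2
  rw [hdet, mul_one, sq_eq_one_iff] at hc
  have hv : hermFunctional (stdVec 0) (stdVec 0) = 1 := by rw [hermFunctional_stdVec, if_pos rfl]
  rcases hc with rfl | rfl
  · exact ⟨⟨x, hx⟩, hxc.trans (one_smul _ _)⟩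
  · refine ⟨⟨-1 * x, mul_mem (vec_mul_self hv ▸ vec_mul_vec_mem_spinGroup hv hv) hx⟩, ?_⟩
    change cliffordAction (-1 * x) = _
    rw [neg_one_mul, map_neg, hxc]
    refine LinearMap.ext fun y => ?_
    change -((-1 : ℂ) • ExteriorAlgebra.map (fundamental 5 A) y) =
      ExteriorAlgebra.map (fundamental 5 A) y
    rw [neg_smul, one_smul, neg_neg]

theorem diracRep_injective : Function.Injective diracRep := fun _ _ h =>
  Subtype.ext (cliffordAction_injective h)

/-- The lift `ψ : SU(5) → Spin(10)` of the exterior algebra representation. -/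
def spinLift : SU 5 →* Spin10 where
  toFun A := (exists_spin_lift A).choose
  -- Faithfulness of `diracRep` makes the chosen lifts unique, hence multiplicative.
  map_one' := diracRep_injective (by rw [(exists_spin_lift 1).choose_spec, map_one, map_one])
  map_mul' A B := diracRep_injective (by
    rw [(exists_spin_lift (A * B)).choose_spec, map_mul, map_mul,
      (exists_spin_lift A).choose_spec, (exists_spin_lift B).choose_spec])

theorem diracRep_spinLift (A : SU 5) : diracRep (spinLift A) = exteriorRep A :=
  (exists_spin_lift A).choose_spec

theorem exteriorRep_apply (A : SU 5) (x : Ext5) :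
    exteriorRep A x = ExteriorAlgebra.map (fundamental 5 A) x := rfl

theorem exteriorRep_injective : Function.Injective exteriorRep := by
  intro A B h
  refine Subtype.ext (Matrix.toLin'.injective (LinearMap.ext fun v => ?_))
  have h1 := LinearMap.congr_fun h (ExteriorAlgebra.ι ℂ v)
  rw [exteriorRep_apply, exteriorRep_apply, ExteriorAlgebra.map_apply_ι,
    ExteriorAlgebra.map_apply_ι, ExteriorAlgebra.ι_inj] at h1
  exact h1

theorem spinLift_injective : Function.Injective spinLift := by
  intro A B h
  refine exteriorRep_injective ?_
  rw [← diracRep_spinLift, ← diracRep_spinLift, h]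

/-! ### Continuity of the lift -/

theorem dual_apply_eq_sum (f : Module.Dual ℂ Ext5) (x : Ext5) :
    f x = ∑ t, extBasis.repr x t * f (extBasis t) := by
  conv_lhs => rw [← extBasis.sum_repr x, map_sum]
  exact Finset.sum_congr rfl fun t _ => map_smul f _ _

/-- The coefficients are polynomials in the entries of `A`: wedging with `z` multiplies them by the
entries of `A z`. -/
theorem continuous_repr_exteriorRep (x : Ext5) (s : Finset (Fin 5)) :
    Continuous fun A : SU 5 => extBasis.repr (exteriorRep A x) s := by
  revert s
  induction x using ext_induction with
  | scalar r =>
    intro s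
    simp only [exteriorRep_apply, AlgHom.commutes]
    exact continuous_const
  | add x y hx hy =>
    intro s
    simp only [map_add, Finsupp.add_apply]
    exact (hx s).add (hy s)
  | create x z hx =>
    intro s
    have h : ∀ A : SU 5, extBasis.repr (exteriorRep A (create z x)) s =
        ∑ i, fundamental 5 A z i * ∑ t, extBasis.repr (exteriorRep A x) t *
          (extBasis.coord s ∘ₗ create (stdVec i)) (extBasis t) := by
      intro A
      have h1 : exteriorRep A (create z x) = create (fundamental 5 A z) (exteriorRep A x) := by
        rw [exteriorRep_apply, create_apply, map_mul, ExteriorAlgebra.map_apply_ι]; rfl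
      simp only [← dual_apply_eq_sum]
      rw [h1, create_eq_sum]
      simp
    simp only [h]
    refine continuous_finsetSum _ fun i _ => Continuous.mul ?_
      (continuous_finsetSum _ fun t _ => (hx t).mul continuous_const)
    change Continuous fun A : SU 5 => ((A : Matrix (Fin 5) (Fin 5) ℂ).mulVec z) i
    fun_prop

/-- Taking matrices of the Clifford action gives an injective real linear map `L` into a coordinate
space. It has a linear, hence continuous, left inverse `G`, so it suffices that the matrix entries
of `exteriorRep A` are continuous in `A`. -/
theorem continuous_spinLift : Continuous spinLift := by
  let L : CliffordAlgebra negForm →ₗ[ℝ] (Finset (Fin 5) × Finset (Fin 5) → ℂ) :=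
    { toFun := fun a p => extBasis.repr (cliffordAction a (extBasis p.1)) p.2
      map_add' := fun a b => by ext p; simp
      map_smul' := fun r a => by
        ext p
        rw [map_smul, LinearMap.smul_apply, ← Complex.coe_smul, map_smul]
        simp }
  have hL : LinearMap.ker L = ⊥ := by
    refine LinearMap.ker_eq_bot.2 fun a b h => cliffordAction_injective (extBasis.ext fun s => ?_)
    refine extBasis.repr.injective (Finsupp.ext fun t => ?_)
    exact congrFun h (s, t)
  obtain ⟨G, hG⟩ := L.exists_leftInverse_of_injective hL
  have : IsModuleTopology ℝ (CliffordAlgebra negForm) := ⟨rfl⟩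
  have : ContinuousAdd (CliffordAlgebra negForm) := IsModuleTopology.toContinuousAdd ℝ _
  have : IsTopologicalAddGroup (CliffordAlgebra negForm) :=
    IsModuleTopology.topologicalAddGroup ℝ _
  have hGc : Continuous G := G.continuous_of_finiteDimensional
  refine Continuous.subtype_mk (f := fun A => (spinLift A : CliffordAlgebra negForm)) ?_ _
  have h : ∀ A, (spinLift A : CliffordAlgebra negForm) = G (L (spinLift A)) := fun A =>
    (LinearMap.congr_fun hG _).symm
  refine (hGc.comp (continuous_pi fun p => ?_)).congr fun A => (h A).symm
  exact (continuous_repr_exteriorRep (extBasis p.1) p.2).congr fun A => by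
    rw [← diracRep_spinLift]; rfl

/-- Needed for a continuous injection of a compact space to be a closed embedding. -/
instance : T2Space (CliffordAlgebra negForm) := by
  have : IsModuleTopology ℝ (CliffordAlgebra negForm) := ⟨rfl⟩
  have : ContinuousAdd (CliffordAlgebra negForm) := IsModuleTopology.toContinuousAdd ℝ _
  exact T2Space.of_injective_continuous cliffordBasis.equivFun.injective
    (IsModuleTopology.continuous_of_linearMap cliffordBasis.equivFun.toLinearMap)

/-! ### The splitting `ℂ⁵ = ℂ² ⊕ ℂ³` -/

/-- The scalar by which `g = (α, A, B)` acts in the representation `α ↦ αⁿ`. -/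
def weight (n : ℤ) (g : GSM) : ℂ := ((g.1 ^ n : Circle) : ℂ)

theorem weight_zero (g : GSM) : weight 0 g = 1 := by simp [weight]

theorem weight_mul (m n : ℤ) (g : GSM) : weight m g * weight n g = weight (m + n) g := by
  rw [weight, weight, weight, zpow_add, Circle.coe_mul]

theorem weight_inv (n : ℤ) (g : GSM) : weight n g⁻¹ = weight (-n) g := by
  rw [weight, weight, Prod.fst_inv, inv_zpow']

/-- The splitting of the index set of `ℂ⁵`. -/
abbrev sumEquiv : Fin 2 ⊕ Fin 3 ≃ Fin 5 := finSumFinEquiv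

/-- The inclusion `ℂ² → ℂ⁵`. -/
def incl₂ : (Fin 2 → ℂ) →ₗ[ℂ] (Fin 5 → ℂ) where
  toFun v := Sum.elim v (0 : Fin 3 → ℂ) ∘ sumEquiv.symm
  map_add' v w := by
    ext r; simp only [Function.comp, Pi.add_apply]; cases sumEquiv.symm r <;> simp
  map_smul' c v := by
    ext r; simp only [Function.comp, Pi.smul_apply]; cases sumEquiv.symm r <;> simp

/-- The inclusion `ℂ³ → ℂ⁵`. -/
def incl₃ : (Fin 3 → ℂ) →ₗ[ℂ] (Fin 5 → ℂ) where
  toFun v := Sum.elim (0 : Fin 2 → ℂ) v ∘ sumEquiv.symm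
  map_add' v w := by
    ext r; simp only [Function.comp, Pi.add_apply]; cases sumEquiv.symm r <;> simp
  map_smul' c v := by
    ext r; simp only [Function.comp, Pi.smul_apply]; cases sumEquiv.symm r <;> simp

/-- The projection `ℂ⁵ → ℂ²`. -/
def proj₂ : (Fin 5 → ℂ) →ₗ[ℂ] (Fin 2 → ℂ) :=
  LinearMap.funLeft ℂ ℂ fun i => sumEquiv (Sum.inl i)

/-- The projection `ℂ⁵ → ℂ³`. -/
def proj₃ : (Fin 5 → ℂ) →ₗ[ℂ] (Fin 3 → ℂ) :=
  LinearMap.funLeft ℂ ℂ fun i => sumEquiv (Sum.inr i)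

theorem proj₂_incl₂ (v : Fin 2 → ℂ) : proj₂ (incl₂ v) = v := by
  ext i; simp [proj₂, incl₂, LinearMap.funLeft_apply]

theorem proj₃_incl₃ (v : Fin 3 → ℂ) : proj₃ (incl₃ v) = v := by
  ext i; simp [proj₃, incl₃, LinearMap.funLeft_apply]

theorem incl_add_incl (z : Fin 5 → ℂ) : incl₂ (proj₂ z) + incl₃ (proj₃ z) = z := by
  ext r
  obtain ⟨s, rfl⟩ := sumEquiv.surjective r
  cases s <;> simp [proj₂, proj₃, incl₂, incl₃, LinearMap.funLeft_apply]

theorem fundamental_phi (g : GSM) (z : Fin 5 → ℂ) :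
    fundamental 5 (phi g) z = weight 3 g • incl₂ (fundamental 2 g.2.1 (proj₂ z)) +
      weight (-2) g • incl₃ (fundamental 3 g.2.2 (proj₃ z)) := by
  have h : fundamental 5 (phi g) z =
      (blockMatrix g).mulVec (z ∘ sumEquiv) ∘ sumEquiv.symm :=
    Matrix.submatrix_mulVec_equiv (blockMatrix g) z sumEquiv.symm sumEquiv.symm
  have h2 : ((g.1⁻¹ ^ 2 : Circle) : ℂ) = weight (-2) g := by
    rw [weight, zpow_neg, inv_pow]; rfl
  have h3 : ((g.1 ^ 3 : Circle) : ℂ) = weight 3 g := rfl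
  have h4 : (z ∘ sumEquiv) ∘ Sum.inl = proj₂ z := rfl
  have h5 : (z ∘ sumEquiv) ∘ Sum.inr = proj₃ z := rfl
  rw [h, blockMatrix, h2, h3, Matrix.fromBlocks_mulVec, h4, h5, Matrix.zero_mulVec,
    Matrix.zero_mulVec, add_zero, zero_add, Matrix.smul_mulVec, Matrix.smul_mulVec]
  ext r
  obtain ⟨s, rfl⟩ := sumEquiv.surjective r
  simp only [Pi.add_apply, Pi.smul_apply, incl₂, incl₃, LinearMap.coe_mk, AddHom.coe_mk,
    Function.comp_apply, Equiv.symm_apply_apply]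
  cases s
  · simp only [Sum.elim_inl, Pi.zero_apply, smul_zero, add_zero]; rfl
  · simp only [Sum.elim_inr, Pi.zero_apply, smul_zero, zero_add]; rfl

theorem fundamental_phi_incl₂ (g : GSM) (v : Fin 2 → ℂ) :
    fundamental 5 (phi g) (incl₂ v) = weight 3 g • incl₂ (fundamental 2 g.2.1 v) := by
  have h : proj₃ (incl₂ v) = 0 := by ext i; simp [proj₃, incl₂, LinearMap.funLeft_apply]
  rw [fundamental_phi, proj₂_incl₂, h]
  simp

theorem fundamental_phi_incl₃ (g : GSM) (v : Fin 3 → ℂ) :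
    fundamental 5 (phi g) (incl₃ v) = weight (-2) g • incl₃ (fundamental 3 g.2.2 v) := by
  have h : proj₂ (incl₃ v) = 0 := by ext i; simp [proj₂, incl₃, LinearMap.funLeft_apply]
  rw [fundamental_phi, proj₃_incl₃, h]
  simp

theorem proj₂_fundamental_phi (g : GSM) (z : Fin 5 → ℂ) :
    proj₂ (fundamental 5 (phi g) z) = weight 3 g • fundamental 2 g.2.1 (proj₂ z) := by
  have h : ∀ v, proj₂ (incl₃ v) = 0 := fun v => by
    ext i; simp [proj₂, incl₃, LinearMap.funLeft_apply]
  rw [fundamental_phi, map_add, map_smul, map_smul, proj₂_incl₂, h, smul_zero, add_zero]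

theorem proj₃_fundamental_phi (g : GSM) (z : Fin 5 → ℂ) :
    proj₃ (fundamental 5 (phi g) z) = weight (-2) g • fundamental 3 g.2.2 (proj₃ z) := by
  have h : ∀ v, proj₃ (incl₂ v) = 0 := fun v => by
    ext i; simp [proj₃, incl₂, LinearMap.funLeft_apply]
  rw [fundamental_phi, map_add, map_smul, map_smul, proj₃_incl₃, h, smul_zero, zero_add]

/-! ### Alternating maps and the special unitary group -/

/-- Both sides are alternating, so they need only be compared on permutations of the standard basis,
where each picks up the sign. -/
theorem alternating_eq_det_smul {n : ℕ} {E : Type*} [AddCommGroup E] [Module ℂ E]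
    (f : (Fin n → ℂ) [⋀^Fin n]→ₗ[ℂ] E) (v : Fin n → Fin n → ℂ) :
    f v = Matrix.det (Matrix.of v) • f fun i => Pi.single i 1 := by
  have h : f = (LinearMap.toSpanSingleton ℂ E (f fun i => Pi.single i 1)).compAlternatingMap
      Matrix.detRowAlternating := by
    refine Module.Basis.ext_alternating (Pi.basisFun ℂ (Fin n)) fun s hs => ?_
    let e : Equiv.Perm (Fin n) := Equiv.ofBijective s (Finite.injective_iff_bijective.1 hs)
    have h1 := f.map_perm (fun i => Pi.single i 1) e
    have h2 := (Matrix.detRowAlternating (R := ℂ)).map_perm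
      (fun i : Fin n => (Pi.single i 1 : Fin n → ℂ)) e
    have h3 : Matrix.detRowAlternating (fun i : Fin n => (Pi.single i 1 : Fin n → ℂ)) = 1 := by
      have : (fun i : Fin n => (Pi.single i 1 : Fin n → ℂ)) = (1 : Matrix (Fin n) (Fin n) ℂ) := by
        ext i j; simp [Matrix.one_apply, Pi.single_apply, eq_comm]
      rw [this]
      exact Matrix.det_one
    rw [h3] at h2
    simp only [Pi.basisFun_apply]
    refine h1.trans ?_
    have h4 : (LinearMap.toSpanSingleton ℂ E (f fun i => Pi.single i 1)).compAlternatingMap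
        Matrix.detRowAlternating (fun i => Pi.single (s i) 1) =
        Matrix.detRowAlternating ((fun i : Fin n => (Pi.single i 1 : Fin n → ℂ)) ∘ e) •
          (f fun i => Pi.single i 1) := rfl
    rw [h4, h2]
    rcases Int.units_eq_one_or (Equiv.Perm.sign e) with h | h <;> simp [h]
  conv_lhs => rw [h]
  rfl

/-- This is the triviality of `Λⁿℂⁿ` for `SU(n)`: volume forms see only the `U(1)` factor. -/
theorem alternating_fundamental {n : ℕ} {E : Type*} [AddCommGroup E] [Module ℂ E]
    (f : (Fin n → ℂ) [⋀^Fin n]→ₗ[ℂ] E) (A : SU n) :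
    (f fun i => fundamental n A (Pi.single i 1)) = f fun i => Pi.single i 1 := by
  have h : Matrix.of (fun i => fundamental n A (Pi.single i 1)) =
      (A : Matrix (Fin n) (Fin n) ℂ).transpose := by
    ext i j; simp [fundamental]
  rw [alternating_eq_det_smul, h, Matrix.det_transpose,
    (Matrix.mem_specialUnitaryGroup_iff.1 A.2).2, one_smul]

/-! ### Building blocks of `Λ*ℂ⁵` -/

/-- The inclusion `ℂ² → Λ¹ℂ⁵`. -/
def form₂ : (Fin 2 → ℂ) →ₗ[ℂ] Ext5 := ExteriorAlgebra.ι ℂ ∘ₗ incl₂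

/-- The inclusion `ℂ³ → Λ¹ℂ⁵`. -/
def form₃ : (Fin 3 → ℂ) →ₗ[ℂ] Ext5 := ExteriorAlgebra.ι ℂ ∘ₗ incl₃

/-- The volume form of `ℂ²`. -/
def vol₂ : Ext5 := form₂ (Pi.single 0 1) * form₂ (Pi.single 1 1)

/-- The volume form of `ℂ³`. -/
def vol₃ : Ext5 := form₃ (Pi.single 0 1) * (form₃ (Pi.single 1 1) * form₃ (Pi.single 2 1))

theorem exteriorRep_mul (A : SU 5) (x y : Ext5) :
    exteriorRep A (x * y) = exteriorRep A x * exteriorRep A y := by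
  simp only [exteriorRep_apply, map_mul]

theorem exteriorRep_form₂ (g : GSM) (v : Fin 2 → ℂ) :
    exteriorRep (phi g) (form₂ v) = weight 3 g • form₂ (fundamental 2 g.2.1 v) := by
  rw [exteriorRep_apply, form₂, LinearMap.comp_apply, ExteriorAlgebra.map_apply_ι,
    fundamental_phi_incl₂, map_smul]
  rfl

theorem exteriorRep_form₃ (g : GSM) (v : Fin 3 → ℂ) :
    exteriorRep (phi g) (form₃ v) = weight (-2) g • form₃ (fundamental 3 g.2.2 v) := by
  rw [exteriorRep_apply, form₃, LinearMap.comp_apply, ExteriorAlgebra.map_apply_ι,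
    fundamental_phi_incl₃, map_smul]
  rfl

theorem exteriorRep_vol₂ (g : GSM) : exteriorRep (phi g) vol₂ = weight 6 g • vol₂ := by
  have h := alternating_fundamental ((ExteriorAlgebra.ιMulti ℂ 2).compLinearMap incl₂) g.2.1
  simp only [AlternatingMap.compLinearMap_apply, ExteriorAlgebra.ιMulti_apply, List.ofFn_succ,
    List.ofFn_zero, List.prod_cons, List.prod_nil, mul_one] at h
  have h' : form₂ (fundamental 2 g.2.1 (Pi.single 0 1)) *
    form₂ (fundamental 2 g.2.1 (Pi.single 1 1)) = vol₂ := h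
  rw [vol₂, exteriorRep_mul, exteriorRep_form₂, exteriorRep_form₂, smul_mul_smul_comm, h',
    weight_mul]
  rfl

theorem exteriorRep_vol₃ (g : GSM) : exteriorRep (phi g) vol₃ = weight (-6) g • vol₃ := by
  have h := alternating_fundamental ((ExteriorAlgebra.ιMulti ℂ 3).compLinearMap incl₃) g.2.2
  simp only [AlternatingMap.compLinearMap_apply, ExteriorAlgebra.ιMulti_apply, List.ofFn_succ,
    List.ofFn_zero, List.prod_cons, List.prod_nil, mul_one] at h
  have h' : form₃ (fundamental 3 g.2.2 (Pi.single 0 1)) *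
    (form₃ (fundamental 3 g.2.2 (Pi.single 1 1)) *
      form₃ (fundamental 3 g.2.2 (Pi.single 2 1))) = vol₃ := h
  rw [vol₃, exteriorRep_mul, exteriorRep_mul, exteriorRep_form₃, exteriorRep_form₃,
    exteriorRep_form₃, smul_mul_smul_comm, smul_mul_smul_comm, h', weight_mul, weight_mul]
  rfl

/-- Contraction with a linear functional. -/
abbrev contract : Module.Dual ℂ (Fin 5 → ℂ) →ₗ[ℂ] Ext5 →ₗ[ℂ] Ext5 :=
  CliffordAlgebra.contractLeft (Q := (0 : QuadraticForm ℂ (Fin 5 → ℂ)))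

theorem contract_create (f : Module.Dual ℂ (Fin 5 → ℂ)) (z : Fin 5 → ℂ) (x : Ext5) :
    contract f (create z x) = f z • x - create z (contract f x) :=
  CliffordAlgebra.contractLeft_ι_mul (Q := (0 : QuadraticForm ℂ (Fin 5 → ℂ))) f z x

theorem contract_algebraMap (f : Module.Dual ℂ (Fin 5 → ℂ)) (r : ℂ) :
    contract f (algebraMap ℂ Ext5 r) = 0 :=
  CliffordAlgebra.contractLeft_algebraMap (Q := (0 : QuadraticForm ℂ (Fin 5 → ℂ))) f r

theorem contract_ι (f : Module.Dual ℂ (Fin 5 → ℂ)) (z : Fin 5 → ℂ) :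
    contract f (ExteriorAlgebra.ι ℂ z) = algebraMap ℂ Ext5 (f z) :=
  CliffordAlgebra.contractLeft_ι (Q := (0 : QuadraticForm ℂ (Fin 5 → ℂ))) f z

theorem contract_map (T : Module.End ℂ (Fin 5 → ℂ)) (f : Module.Dual ℂ (Fin 5 → ℂ)) (x : Ext5) :
    contract f (ExteriorAlgebra.map T x) = ExteriorAlgebra.map T (contract (f ∘ₗ T) x) := by
  induction x using ext_induction with
  | scalar r => rw [AlgHom.commutes, contract_algebraMap, contract_algebraMap, map_zero]
  | add x y hx hy => simp only [map_add, hx, hy]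
  | create x z hx =>
    have h : ∀ y, ExteriorAlgebra.map T (create z y) = create (T z) (ExteriorAlgebra.map T y) :=
      fun y => by rw [create_apply, map_mul, ExteriorAlgebra.map_apply_ι]; rfl
    rw [h, contract_create, contract_create, map_sub, map_smul, h, hx]
    rfl

/-- Contraction is natural, with functionals transported by the contragredient action. -/
theorem exteriorRep_contract (A : SU 5) (f : Module.Dual ℂ (Fin 5 → ℂ)) (x : Ext5) :
    exteriorRep A (contract f x) = contract (f ∘ₗ fundamental 5 A⁻¹) (exteriorRep A x) := by
  have h : (f ∘ₗ fundamental 5 A⁻¹) ∘ₗ fundamental 5 A = f := by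
    rw [LinearMap.comp_assoc, ← Module.End.mul_eq_comp, ← map_mul, inv_mul_cancel, map_one]
    rfl
  rw [exteriorRep_apply, exteriorRep_apply, contract_map, h]

/-- The isomorphism `(ℂ²)* → Λ¹ℂ²` given by contraction of the volume form. -/
def star₂ : Module.Dual ℂ (Fin 2 → ℂ) →ₗ[ℂ] Ext5 :=
  contract.flip vol₂ ∘ₗ LinearMap.lcomp ℂ ℂ proj₂

/-- The isomorphism `(ℂ³)* → Λ²ℂ³` given by contraction of the volume form. -/
def star₃ : Module.Dual ℂ (Fin 3 → ℂ) →ₗ[ℂ] Ext5 :=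
  contract.flip vol₃ ∘ₗ LinearMap.lcomp ℂ ℂ proj₃

theorem star₂_apply (f : Module.Dual ℂ (Fin 2 → ℂ)) : star₂ f = contract (f ∘ₗ proj₂) vol₂ := rfl

theorem star₃_apply (f : Module.Dual ℂ (Fin 3 → ℂ)) : star₃ f = contract (f ∘ₗ proj₃) vol₃ := rfl

/-- The volume form contributes weight `6` and the dual of `ℂ²` contributes `-3`. -/
theorem exteriorRep_star₂ (g : GSM) (f : Module.Dual ℂ (Fin 2 → ℂ)) :
    exteriorRep (phi g) (star₂ f) = weight 3 g • star₂ (f ∘ₗ fundamental 2 g⁻¹.2.1) := by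
  have h : (f ∘ₗ proj₂) ∘ₗ fundamental 5 (phi g)⁻¹ =
      weight (-3) g • ((f ∘ₗ fundamental 2 g⁻¹.2.1) ∘ₗ proj₂) := by
    refine LinearMap.ext fun z => ?_
    rw [← map_inv, LinearMap.comp_apply, LinearMap.comp_apply, proj₂_fundamental_phi, weight_inv,
      map_smul]
    rfl
  rw [star₂_apply, exteriorRep_contract, exteriorRep_vol₂, h, map_smul, map_smul,
    LinearMap.smul_apply, smul_smul, weight_mul]
  rfl

/-- The volume form contributes weight `-6` and the dual of `ℂ³` contributes `2`. -/
theorem exteriorRep_star₃ (g : GSM) (f : Module.Dual ℂ (Fin 3 → ℂ)) :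
    exteriorRep (phi g) (star₃ f) = weight (-4) g • star₃ (f ∘ₗ fundamental 3 g⁻¹.2.2) := by
  have h : (f ∘ₗ proj₃) ∘ₗ fundamental 5 (phi g)⁻¹ =
      weight 2 g • ((f ∘ₗ fundamental 3 g⁻¹.2.2) ∘ₗ proj₃) := by
    refine LinearMap.ext fun z => ?_
    rw [← map_inv, LinearMap.comp_apply, LinearMap.comp_apply, proj₃_fundamental_phi, weight_inv,
      map_smul]
    rfl
  rw [star₃_apply, exteriorRep_contract, exteriorRep_vol₃, h, map_smul, map_smul,
    LinearMap.smul_apply, smul_smul, weight_mul]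
  rfl

/-! ### Products of the building blocks span `Λ*ℂ⁵` -/

theorem form₂_mul_vol₂ (v : Fin 2 → ℂ) : form₂ v * vol₂ = 0 := by
  have h : v = v 0 • Pi.single 0 1 + v 1 • Pi.single 1 1 := by
    ext i; fin_cases i <;> simp
  have hs : ∀ u, form₂ u * form₂ u = 0 := fun u => ExteriorAlgebra.ι_sq_zero _
  have hc : ∀ u w, form₂ u * form₂ w = -(form₂ w * form₂ u) := fun u w =>
    eq_neg_of_add_eq_zero_left (ExteriorAlgebra.ι_add_mul_swap _ _)
  rw [h, vol₂, map_add, map_smul, map_smul, add_mul, smul_mul_assoc, smul_mul_assoc, ← mul_assoc,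
    hs, hc (Pi.single 0 1), mul_neg, ← mul_assoc, hs]
  simp

theorem form₂_mul_form₂ (v w : Fin 2 → ℂ) :
    form₂ v * form₂ w = (v 0 * w 1 - v 1 * w 0) • vol₂ := by
  have h : ∀ v : Fin 2 → ℂ, v = v 0 • Pi.single 0 1 + v 1 • Pi.single 1 1 := fun v => by
    ext i; fin_cases i <;> simp
  have hs : ∀ u, form₂ u * form₂ u = 0 := fun u => ExteriorAlgebra.ι_sq_zero _
  have hc : form₂ (Pi.single 1 1) * form₂ (Pi.single 0 1) = -vol₂ :=
    eq_neg_of_add_eq_zero_left (ExteriorAlgebra.ι_add_mul_swap _ _)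
  conv_lhs => rw [h v, h w]
  simp only [map_add, map_smul, add_mul, mul_add, smul_mul_smul_comm, hs, hc]
  rw [← vol₂]
  module

theorem form₂_mem_range_star₂ (v : Fin 2 → ℂ) : form₂ v ∈ LinearMap.range star₂ := by
  have h : v = v 0 • Pi.single 0 1 + v 1 • Pi.single 1 1 := by
    ext i; fin_cases i <;> simp
  have hstar : ∀ f, star₂ f = f (Pi.single 0 1) • form₂ (Pi.single 1 1) -
      f (Pi.single 1 1) • form₂ (Pi.single 0 1) := by
    intro f
    have hv : vol₂ = create (incl₂ (Pi.single 0 1)) (ExteriorAlgebra.ι ℂ (incl₂ (Pi.single 1 1))) :=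
      rfl
    rw [star₂_apply, hv, contract_create, contract_ι, create_apply, ← Algebra.commutes,
      ← Algebra.smul_def, LinearMap.comp_apply, LinearMap.comp_apply, proj₂_incl₂, proj₂_incl₂]
    rfl
  -- By `hstar`, the values on the two basis vectors must be `v 1` and `-v 0`.
  refine ⟨v 1 • LinearMap.proj 0 - v 0 • LinearMap.proj 1, ?_⟩
  conv_rhs => rw [h]
  rw [hstar]
  simp
  abel

theorem form₃_mul_form₃_mem (v w : Fin 3 → ℂ) : form₃ v * form₃ w ∈ LinearMap.range star₃ := by
  have h : ∀ v : Fin 3 → ℂ, v = v 0 • Pi.single 0 1 + v 1 • Pi.single 1 1 + v 2 • Pi.single 2 1 :=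
    fun v => by ext i; fin_cases i <;> simp
  have hs : ∀ u, form₃ u * form₃ u = 0 := fun u => ExteriorAlgebra.ι_sq_zero _
  have hc : ∀ u w, form₃ u * form₃ w = -(form₃ w * form₃ u) := fun u w =>
    eq_neg_of_add_eq_zero_left (ExteriorAlgebra.ι_add_mul_swap _ _)
  have hstar : ∀ f, star₃ f = f (Pi.single 0 1) • (form₃ (Pi.single 1 1) * form₃ (Pi.single 2 1)) -
      f (Pi.single 1 1) • (form₃ (Pi.single 0 1) * form₃ (Pi.single 2 1)) +
      f (Pi.single 2 1) • (form₃ (Pi.single 0 1) * form₃ (Pi.single 1 1)) := by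
    intro f
    have hv : vol₃ = create (incl₃ (Pi.single 0 1)) (create (incl₃ (Pi.single 1 1))
      (ExteriorAlgebra.ι ℂ (incl₃ (Pi.single 2 1)))) := rfl
    rw [star₃_apply, hv, contract_create, contract_create, contract_ι]
    simp only [create_apply]
    rw [← Algebra.commutes, ← Algebra.smul_def]
    simp only [LinearMap.comp_apply, proj₃_incl₃, mul_sub, mul_smul_comm]
    change _ • (form₃ _ * form₃ _) - (_ • (form₃ _ * form₃ _) - _ • (form₃ _ * form₃ _)) = _
    abel
  -- The coefficients are those of the cross product of `v` and `w`.
  refine ⟨(v 1 * w 2 - v 2 * w 1) • LinearMap.proj 0 - (v 0 * w 2 - v 2 * w 0) • LinearMap.proj 1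
    + (v 0 * w 1 - v 1 * w 0) • LinearMap.proj 2, ?_⟩
  conv_rhs => rw [h v, h w]
  rw [hstar]
  simp only [map_add, map_smul, add_mul, mul_add, smul_mul_smul_comm, hs,
    hc (Pi.single 1 1) (Pi.single 0 1), hc (Pi.single 2 1) (Pi.single 0 1),
    hc (Pi.single 2 1) (Pi.single 1 1)]
  simp
  module

theorem form₃_mul_vol₃ (v : Fin 3 → ℂ) : form₃ v * vol₃ = 0 := by
  have h : v = v 0 • Pi.single 0 1 + v 1 • Pi.single 1 1 + v 2 • Pi.single 2 1 := by
    ext i; fin_cases i <;> simp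
  have hs : ∀ u x, form₃ u * (form₃ u * x) = 0 := fun u => create_create_self _
  have hs' : ∀ u, form₃ u * form₃ u = 0 := fun u => ExteriorAlgebra.ι_sq_zero _
  have hc : ∀ u w x, form₃ u * (form₃ w * x) = -(form₃ w * (form₃ u * x)) := fun u w =>
    create_comm _ _
  rw [h, vol₃]
  simp only [map_add, map_smul, add_mul, smul_mul_assoc, hs, hc (Pi.single 1 1) (Pi.single 0 1),
    hc (Pi.single 2 1) (Pi.single 0 1), hc (Pi.single 2 1) (Pi.single 1 1), hs', mul_zero,
    neg_zero, smul_zero, add_zero]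

/-- Contract the identity `v ∧ vol₃ = 0` with `f`, using the antiderivation rule. -/
theorem form₃_mul_star₃ (v : Fin 3 → ℂ) (f : Module.Dual ℂ (Fin 3 → ℂ)) :
    form₃ v * star₃ f = f v • vol₃ := by
  have h := contract_create (f ∘ₗ proj₃) (incl₃ v) vol₃
  have h0 : create (incl₃ v) vol₃ = 0 := form₃_mul_vol₃ v
  rw [h0, map_zero, LinearMap.comp_apply, proj₃_incl₃] at h
  exact (sub_eq_zero.1 h.symm).symm

/-- The exterior algebra of `ℂ²` inside `Λ*ℂ⁵`. -/
def ext₂ : Submodule ℂ Ext5 :=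
  Submodule.span ℂ {1} ⊔ LinearMap.range form₂ ⊔ Submodule.span ℂ {vol₂}

/-- The exterior algebra of `ℂ³` inside `Λ*ℂ⁵`. -/
def ext₃ : Submodule ℂ Ext5 :=
  Submodule.span ℂ {1} ⊔ LinearMap.range form₃ ⊔ LinearMap.range star₃ ⊔ Submodule.span ℂ {vol₃}

theorem form₂_mul_ext₂ (v : Fin 2 → ℂ) :
    ext₂ ≤ ext₂.comap (LinearMap.mulLeft ℂ (form₂ v)) := by
  conv_lhs => rw [ext₂]
  refine sup_le (sup_le ?_ ?_) ?_
  · rw [Submodule.span_singleton_le_iff_mem, Submodule.mem_comap, LinearMap.mulLeft_apply, mul_one]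
    exact Submodule.mem_sup_left (Submodule.mem_sup_right ⟨v, rfl⟩)
  · rintro _ ⟨w, rfl⟩
    rw [Submodule.mem_comap, LinearMap.mulLeft_apply, form₂_mul_form₂]
    exact Submodule.mem_sup_right (Submodule.smul_mem _ _ (Submodule.mem_span_singleton_self _))
  · rw [Submodule.span_singleton_le_iff_mem, Submodule.mem_comap, LinearMap.mulLeft_apply,
      form₂_mul_vol₂]
    exact zero_mem _

theorem form₃_mul_ext₃ (v : Fin 3 → ℂ) :
    ext₃ ≤ ext₃.comap (LinearMap.mulLeft ℂ (form₃ v)) := by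
  conv_lhs => rw [ext₃]
  refine sup_le (sup_le (sup_le ?_ ?_) ?_) ?_
  · rw [Submodule.span_singleton_le_iff_mem, Submodule.mem_comap, LinearMap.mulLeft_apply, mul_one]
    exact Submodule.mem_sup_left (Submodule.mem_sup_left (Submodule.mem_sup_right ⟨v, rfl⟩))
  · rintro _ ⟨w, rfl⟩
    exact Submodule.mem_sup_left (Submodule.mem_sup_right (form₃_mul_form₃_mem v w))
  · rintro _ ⟨f, rfl⟩
    rw [Submodule.mem_comap, LinearMap.mulLeft_apply, form₃_mul_star₃]
    exact Submodule.mem_sup_right (Submodule.smul_mem _ _ (Submodule.mem_span_singleton_self _))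
  · rw [Submodule.span_singleton_le_iff_mem, Submodule.mem_comap, LinearMap.mulLeft_apply,
      form₃_mul_vol₃]
    exact zero_mem _

/-- Vectors of `ℂ³` move past forms on `ℂ²`. -/
theorem form₃_mul_mem_ext₂_mul (v : Fin 3 → ℂ) {y : Ext5} (hy : y ∈ ext₃) :
    ext₂ ≤ (ext₂ * ext₃).comap (LinearMap.mulLeft ℂ (form₃ v) ∘ₗ LinearMap.mulRight ℂ y) := by
  have hc : ∀ w, form₃ v * form₂ w = -(form₂ w * form₃ v) := fun w =>
    eq_neg_of_add_eq_zero_left (ExteriorAlgebra.ι_add_mul_swap _ _)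
  have hvol : form₃ v * vol₂ = vol₂ * form₃ v := by
    rw [vol₂, ← mul_assoc, hc, neg_mul, mul_assoc, hc, mul_neg, neg_neg, mul_assoc]
  have hmem : ∀ x ∈ ext₂, x * (form₃ v * y) ∈ ext₂ * ext₃ := fun x hx =>
    Submodule.mul_mem_mul hx (form₃_mul_ext₃ v hy)
  have h1 : (1 : Ext5) ∈ ext₂ := Submodule.mem_sup_left (Submodule.mem_sup_left
    (Submodule.mem_span_singleton_self _))
  have h2 : vol₂ ∈ ext₂ := Submodule.mem_sup_right (Submodule.mem_span_singleton_self _)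
  conv_lhs => rw [ext₂]
  refine sup_le (sup_le ?_ ?_) ?_
  · rw [Submodule.span_singleton_le_iff_mem]
    have := hmem 1 h1
    rw [one_mul] at this
    change form₃ v * (1 * y) ∈ ext₂ * ext₃
    rwa [one_mul]
  · rintro _ ⟨w, rfl⟩
    change form₃ v * (form₂ w * y) ∈ ext₂ * ext₃
    rw [← mul_assoc, hc, neg_mul, mul_assoc]
    exact neg_mem (hmem _ (Submodule.mem_sup_left (Submodule.mem_sup_right ⟨w, rfl⟩)))
  · rw [Submodule.span_singleton_le_iff_mem]
    change form₃ v * (vol₂ * y) ∈ ext₂ * ext₃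
    rw [← mul_assoc, hvol, mul_assoc]
    exact hmem _ h2

/-- The product contains `1` and is stable under wedging with vectors of `ℂ²` and of `ℂ³`. -/
theorem ext₂_mul_ext₃ : ext₂ * ext₃ = ⊤ := by
  refine eq_top_of_one_mem (fun z x hx => ?_) ?_
  · have h : ∀ x, create z x = form₂ (proj₂ z) * x + form₃ (proj₃ z) * x := fun x => by
      conv_lhs => rw [create_apply, ← incl_add_incl z, map_add, add_mul]
      rfl
    induction hx using Submodule.mul_induction_on' with
    | mem_mul_mem a ha b hb =>
      rw [h]
      refine add_mem ?_ (form₃_mul_mem_ext₂_mul _ hb ha)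
      rw [← mul_assoc]
      exact Submodule.mul_mem_mul (form₂_mul_ext₂ _ ha) hb
    | add a _ b _ ha hb =>
      rw [map_add]
      exact add_mem ha hb
  · have h := Submodule.mul_mem_mul (M := ext₂) (N := ext₃)
      (Submodule.mem_sup_left (Submodule.mem_sup_left (Submodule.mem_span_singleton_self 1)))
      (Submodule.mem_sup_left (Submodule.mem_sup_left (Submodule.mem_sup_left
        (Submodule.mem_span_singleton_self 1))))
    rwa [one_mul] at h

/-! ### Equivariant maps from a representation and its dual to `Λ*ℂ⁵` -/

/-- Equivariant maps from a representation of `G_SM` and from its dual to `Λ*ℂ⁵`. -/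
structure EquivariantPair {V : Type} [AddCommGroup V] [Module ℂ V]
    (ρ : Representation ℂ GSM V) where
  /-- The map from the representation. -/
  toMap : V →ₗ[ℂ] Ext5
  /-- The map from the dual representation. -/
  toDualMap : Module.Dual ℂ V →ₗ[ℂ] Ext5
  exteriorRep_toMap : ∀ g v, exteriorRep (phi g) (toMap v) = toMap (ρ g v)
  exteriorRep_toDualMap : ∀ g f, exteriorRep (phi g) (toDualMap f) = toDualMap (f ∘ₗ ρ g⁻¹)

namespace EquivariantPair

variable {V W : Type} [AddCommGroup V] [Module ℂ V] [AddCommGroup W] [Module ℂ W]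

/-- The subspace spanned by the images of the two maps. -/
def range {ρ : Representation ℂ GSM V} (T : EquivariantPair ρ) : Submodule ℂ Ext5 :=
  LinearMap.range T.toMap ⊔ LinearMap.range T.toDualMap

/-- The equivariant maps from a direct sum. -/
def prod {ρ : Representation ℂ GSM V} {σ : Representation ℂ GSM W} (S : EquivariantPair ρ)
    (T : EquivariantPair σ) : EquivariantPair (ρ.prod σ) where
  toMap := S.toMap.coprod T.toMap
  toDualMap := S.toDualMap ∘ₗ LinearMap.lcomp ℂ ℂ (LinearMap.inl ℂ V W) +
    T.toDualMap ∘ₗ LinearMap.lcomp ℂ ℂ (LinearMap.inr ℂ V W)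
  exteriorRep_toMap g v := by
    simp [S.exteriorRep_toMap, T.exteriorRep_toMap]
  exteriorRep_toDualMap g f := by
    have h1 : (f ∘ₗ (ρ.prod σ) g⁻¹) ∘ₗ LinearMap.inl ℂ V W =
        (f ∘ₗ LinearMap.inl ℂ V W) ∘ₗ ρ g⁻¹ := by ext; simp
    have h2 : (f ∘ₗ (ρ.prod σ) g⁻¹) ∘ₗ LinearMap.inr ℂ V W =
        (f ∘ₗ LinearMap.inr ℂ V W) ∘ₗ σ g⁻¹ := by ext; simp
    simp only [LinearMap.add_apply, LinearMap.comp_apply, LinearMap.lcomp_apply', h1, h2, map_add,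
      S.exteriorRep_toDualMap, T.exteriorRep_toDualMap]

theorem range_prod_left {ρ : Representation ℂ GSM V} {σ : Representation ℂ GSM W}
    (S : EquivariantPair ρ) (T : EquivariantPair σ) : S.range ≤ (S.prod T).range := by
  refine sup_le_sup ?_ ?_
  · rintro _ ⟨v, rfl⟩
    exact ⟨(v, 0), by simp [prod]⟩
  · rintro _ ⟨f, rfl⟩
    refine ⟨f ∘ₗ LinearMap.fst ℂ V W, ?_⟩
    simp [prod, LinearMap.lcomp_apply', LinearMap.comp_assoc]

theorem range_prod_right {ρ : Representation ℂ GSM V} {σ : Representation ℂ GSM W}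
    (S : EquivariantPair ρ) (T : EquivariantPair σ) : T.range ≤ (S.prod T).range := by
  refine sup_le_sup ?_ ?_
  · rintro _ ⟨v, rfl⟩
    exact ⟨(0, v), by simp [prod]⟩
  · rintro _ ⟨f, rfl⟩
    refine ⟨f ∘ₗ LinearMap.snd ℂ V W, ?_⟩
    simp [prod, LinearMap.lcomp_apply', LinearMap.comp_assoc]

/-- The equivalence of representations obtained from a surjective equivariant pair by comparing
dimensions. -/
def equiv [Module.Finite ℂ V] {ρ : Representation ℂ GSM V} (T : EquivariantPair ρ)
    (hT : T.range = ⊤) (hV : Module.finrank ℂ V = 16) :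
    (ρ.prod ρ.dual).Equiv (exteriorRep.comp phi) :=
  Representation.Equiv.mk
    (LinearEquiv.ofBijective (T.toMap.coprod T.toDualMap) (by
      have hs : Function.Surjective (T.toMap.coprod T.toDualMap) := by
        rw [← LinearMap.range_eq_top, LinearMap.range_coprod]
        exact hT
      refine ⟨(LinearMap.injective_iff_surjective_of_finrank_eq_finrank ?_).2 hs, hs⟩
      rw [finrank_ext, Module.finrank_prod, Subspace.dual_finrank_eq, hV]))
    (fun g => LinearMap.ext fun x => by
      change T.toMap (ρ g x.1) + T.toDualMap (x.2 ∘ₗ ρ g⁻¹) =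
        exteriorRep (phi g) (T.toMap x.1 + T.toDualMap x.2)
      rw [map_add, T.exteriorRep_toMap, T.exteriorRep_toDualMap])

variable [Module.Finite ℂ V] [Module.Finite ℂ W]

/-- The equivariant maps from a particle representation, as products of equivariant maps from the
tensor factors. -/
def ofParticle {k : ℤ} {σ : Representation ℂ (SU 2) V} {τ : Representation ℂ (SU 3) W}
    {L : V →ₗ[ℂ] Ext5} {M : W →ₗ[ℂ] Ext5} {L' : Module.Dual ℂ V →ₗ[ℂ] Ext5}
    {M' : Module.Dual ℂ W →ₗ[ℂ] Ext5} {a b a' b' : ℤ}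
    (hL : ∀ g v, exteriorRep (phi g) (L v) = weight a g • L (σ g.2.1 v))
    (hM : ∀ g w, exteriorRep (phi g) (M w) = weight b g • M (τ g.2.2 w))
    (hL' : ∀ g f, exteriorRep (phi g) (L' f) = weight a' g • L' (f ∘ₗ σ g⁻¹.2.1))
    (hM' : ∀ g f, exteriorRep (phi g) (M' f) = weight b' g • M' (f ∘ₗ τ g⁻¹.2.2))
    (hk : a + b = k) (hk' : a' + b' = -k) : EquivariantPair (particle k σ τ) where
  toMap := TensorProduct.lift ((LinearMap.mul ℂ Ext5).compl₁₂ L M) ∘ₗ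
    (TensorProduct.lid ℂ (V ⊗[ℂ] W)).toLinearMap
  toDualMap := TensorProduct.lift ((LinearMap.mul ℂ Ext5).compl₁₂ L' M') ∘ₗ
    (TensorProduct.dualDistribEquiv ℂ V W).symm.toLinearMap ∘ₗ
      LinearMap.lcomp ℂ ℂ (TensorProduct.lid ℂ (V ⊗[ℂ] W)).symm.toLinearMap
  exteriorRep_toMap g x := by
    induction x using TensorProduct.induction_on with
    | zero => simp only [map_zero]
    | add x y hx hy => simp only [map_add, hx, hy]
    | tmul c y =>
      induction y using TensorProduct.induction_on with
      | zero => simp only [TensorProduct.tmul_zero, map_zero]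
      | add x y hx hy => simp only [TensorProduct.tmul_add, map_add, hx, hy]
      | tmul v w =>
        have h : particle k σ τ g (c ⊗ₜ (v ⊗ₜ w)) =
          (weight k g • c) ⊗ₜ (σ g.2.1 v ⊗ₜ τ g.2.2 w) := rfl
        rw [h]
        simp only [LinearMap.comp_apply, LinearEquiv.coe_coe, TensorProduct.lid_tmul, map_smul,
          TensorProduct.lift.tmul, LinearMap.compl₁₂_apply, LinearMap.mul_apply', exteriorRep_mul,
          hL, hM, smul_mul_smul_comm, weight_mul, hk, smul_smul, smul_eq_mul, mul_comm c]
  exteriorRep_toDualMap g f := by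
    -- In finite dimension every functional comes from a tensor of functionals, which reduces the
    -- claim to pure tensors.
    obtain ⟨t, rfl⟩ : ∃ t, (TensorProduct.dualDistribEquiv ℂ V W t) ∘ₗ
        (TensorProduct.lid ℂ (V ⊗[ℂ] W)).toLinearMap = f := by
      refine ⟨(TensorProduct.dualDistribEquiv ℂ V W).symm
        (f ∘ₗ (TensorProduct.lid ℂ (V ⊗[ℂ] W)).symm.toLinearMap), ?_⟩
      rw [LinearEquiv.apply_symm_apply, LinearMap.comp_assoc, LinearEquiv.comp_coe,
        LinearEquiv.self_trans_symm]
      rfl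
    have h0 : ∀ t, ((TensorProduct.dualDistribEquiv ℂ V W t) ∘ₗ
        (TensorProduct.lid ℂ (V ⊗[ℂ] W)).toLinearMap) ∘ₗ
        (TensorProduct.lid ℂ (V ⊗[ℂ] W)).symm.toLinearMap =
        TensorProduct.dualDistribEquiv ℂ V W t := fun t => by
      rw [LinearMap.comp_assoc, LinearEquiv.comp_coe, LinearEquiv.symm_trans_self]
      rfl
    induction t using TensorProduct.induction_on with
    | zero => simp only [map_zero, LinearMap.zero_comp]
    | add x y hx hy => simp only [map_add, LinearMap.add_comp, hx, hy]
    | tmul f h =>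
      have e : ((TensorProduct.dualDistribEquiv ℂ V W (f ⊗ₜ h)) ∘ₗ
          (TensorProduct.lid ℂ (V ⊗[ℂ] W)).toLinearMap) ∘ₗ particle k σ τ g⁻¹ =
          weight (-k) g • (TensorProduct.dualDistribEquiv ℂ V W
            ((f ∘ₗ σ g⁻¹.2.1) ⊗ₜ (h ∘ₗ τ g⁻¹.2.2))) ∘ₗ
              (TensorProduct.lid ℂ (V ⊗[ℂ] W)).toLinearMap := by
        refine TensorProduct.ext' fun c y => ?_
        induction y using TensorProduct.induction_on with
        | zero => simp only [TensorProduct.tmul_zero, map_zero]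
        | add x y hx hy => simp only [TensorProduct.tmul_add, map_add, hx, hy]
        | tmul v w =>
          have h : particle k σ τ g⁻¹ (c ⊗ₜ (v ⊗ₜ w)) =
            (weight k g⁻¹ • c) ⊗ₜ (σ g⁻¹.2.1 v ⊗ₜ τ g⁻¹.2.2 w) := rfl
          rw [LinearMap.comp_apply, h, weight_inv]
          simp only [LinearMap.comp_apply, LinearEquiv.coe_coe, TensorProduct.lid_tmul, map_smul,
            LinearMap.smul_apply, smul_assoc]
          rfl
      rw [e]
      simp only [map_smul, LinearMap.comp_apply, LinearMap.lcomp_apply', h0, LinearEquiv.coe_coe,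
        LinearEquiv.symm_apply_apply, TensorProduct.lift.tmul, LinearMap.compl₁₂_apply,
        LinearMap.mul_apply', exteriorRep_mul, hL', hM', smul_mul_smul_comm, weight_mul, hk']

section

variable {k : ℤ} {σ : Representation ℂ (SU 2) V} {τ : Representation ℂ (SU 3) W}
    {L : V →ₗ[ℂ] Ext5} {M : W →ₗ[ℂ] Ext5} {L' : Module.Dual ℂ V →ₗ[ℂ] Ext5}
    {M' : Module.Dual ℂ W →ₗ[ℂ] Ext5} {a b a' b' : ℤ}
    (hL : ∀ g v, exteriorRep (phi g) (L v) = weight a g • L (σ g.2.1 v))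
    (hM : ∀ g w, exteriorRep (phi g) (M w) = weight b g • M (τ g.2.2 w))
    (hL' : ∀ g f, exteriorRep (phi g) (L' f) = weight a' g • L' (f ∘ₗ σ g⁻¹.2.1))
    (hM' : ∀ g f, exteriorRep (phi g) (M' f) = weight b' g • M' (f ∘ₗ τ g⁻¹.2.2))
    (hk : a + b = k) (hk' : a' + b' = -k)

/-- Lower bounds on the range suffice, since only surjectivity is proved directly and injectivity
follows by dimension. -/
theorem range_mul_range_le_ofParticle :
    LinearMap.range L * LinearMap.range M ≤ (ofParticle hL hM hL' hM' hk hk').range := by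
  refine le_sup_of_le_left (Submodule.mul_le.2 ?_)
  rintro _ ⟨v, rfl⟩ _ ⟨w, rfl⟩
  refine ⟨1 ⊗ₜ (v ⊗ₜ w), ?_⟩
  simp [ofParticle]

theorem range_dual_mul_range_dual_le_ofParticle :
    LinearMap.range L' * LinearMap.range M' ≤ (ofParticle hL hM hL' hM' hk hk').range := by
  refine le_sup_of_le_right (Submodule.mul_le.2 ?_)
  rintro _ ⟨f, rfl⟩ _ ⟨h, rfl⟩
  refine ⟨(TensorProduct.dualDistribEquiv ℂ V W (f ⊗ₜ h)) ∘ₗ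
    (TensorProduct.lid ℂ (V ⊗[ℂ] W)).toLinearMap, ?_⟩
  have h0 : ((TensorProduct.dualDistribEquiv ℂ V W (f ⊗ₜ h)) ∘ₗ
      (TensorProduct.lid ℂ (V ⊗[ℂ] W)).toLinearMap) ∘ₗ
      (TensorProduct.lid ℂ (V ⊗[ℂ] W)).symm.toLinearMap =
      TensorProduct.dualDistribEquiv ℂ V W (f ⊗ₜ h) := by
    rw [LinearMap.comp_assoc, LinearEquiv.comp_coe, LinearEquiv.symm_trans_self]
    rfl
  simp only [ofParticle, LinearMap.comp_apply, LinearMap.lcomp_apply', h0, LinearEquiv.coe_coe,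
    LinearEquiv.symm_apply_apply, TensorProduct.lift.tmul, LinearMap.compl₁₂_apply,
    LinearMap.mul_apply']

end

end EquivariantPair

/-! ### The fermion representation inside `Λ*ℂ⁵` -/

/-- The line spanned by a form. -/
abbrev line (x : Ext5) : ℂ →ₗ[ℂ] Ext5 := LinearMap.toSpanSingleton ℂ Ext5 x

/-- The line spanned by a form, parametrized by the dual of `ℂ`. -/
def dualLine (x : Ext5) : Module.Dual ℂ ℂ →ₗ[ℂ] Ext5 := line x ∘ₗ LinearMap.applyₗ 1

theorem range_line (x : Ext5) : LinearMap.range (line x) = Submodule.span ℂ {x} :=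
  LinearMap.range_toSpanSingleton x

theorem range_dualLine (x : Ext5) : LinearMap.range (dualLine x) = Submodule.span ℂ {x} := by
  rw [← range_line, dualLine]
  exact LinearMap.range_comp_of_range_eq_top _
    (LinearMap.range_eq_top.2 fun c => ⟨c • LinearMap.id, by simp⟩)

/-- The map `A` is arbitrary because the singlet is trivial; it only matches the form required by
`ofParticle`. -/
theorem exteriorRep_line {x : Ext5} {a : ℤ} (hx : ∀ g, exteriorRep (phi g) x = weight a g • x)
    (n : ℕ) (A : GSM → SU n) (g : GSM) (c : ℂ) :
    exteriorRep (phi g) (line x c) = weight a g • line x (singlet n (A g) c) := by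
  rw [LinearMap.toSpanSingleton_apply, map_smul, hx, smul_comm]
  rfl

theorem exteriorRep_dualLine {x : Ext5} {a : ℤ}
    (hx : ∀ g, exteriorRep (phi g) x = weight a g • x) (n : ℕ) (A : GSM → SU n) (g : GSM)
    (f : Module.Dual ℂ ℂ) :
    exteriorRep (phi g) (dualLine x f) = weight a g • dualLine x (f ∘ₗ singlet n (A g)) := by
  rw [dualLine, LinearMap.comp_apply, LinearMap.toSpanSingleton_apply, map_smul, hx, smul_comm]
  rfl

theorem exteriorRep_one (g : GSM) : exteriorRep (phi g) 1 = weight 0 g • (1 : Ext5) := by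
  rw [weight_zero, one_smul, exteriorRep_apply, map_one]

/-- Left-handed leptons as `Λ¹ℂ² ⊗ Λ³ℂ³`, and their antiparticles as `Λ¹ℂ²`. -/
def leptonLPair : EquivariantPair leptonL :=
  EquivariantPair.ofParticle (L := form₂) (M := line vol₃) (L' := star₂) (M' := dualLine 1)
    exteriorRep_form₂ (exteriorRep_line exteriorRep_vol₃ 3 fun g => g.2.2)
    -- The two `rfl` are the charge checks `3 + (-6) = -3` and `3 + 0 = 3`.
    exteriorRep_star₂ (exteriorRep_dualLine exteriorRep_one 3 fun g => g⁻¹.2.2) rfl rfl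

/-- Left-handed quarks as `Λ¹ℂ² ⊗ Λ¹ℂ³`, and their antiparticles as `Λ¹ℂ² ⊗ Λ²ℂ³`. -/
def quarkLPair : EquivariantPair quarkL :=
  EquivariantPair.ofParticle (L := form₂) (M := form₃) (L' := star₂) (M' := star₃)
    exteriorRep_form₂ exteriorRep_form₃ exteriorRep_star₂ exteriorRep_star₃ rfl rfl

/-- The right-handed neutrino as `Λ⁰`, and its antiparticle as `Λ⁵`. -/
def neutrinoRPair : EquivariantPair neutrinoR :=
  EquivariantPair.ofParticle (L := line 1) (M := line 1) (L' := dualLine vol₂)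
    (M' := dualLine vol₃)
    (exteriorRep_line exteriorRep_one 2 fun g => g.2.1)
    (exteriorRep_line exteriorRep_one 3 fun g => g.2.2)
    (exteriorRep_dualLine exteriorRep_vol₂ 2 fun g => g⁻¹.2.1)
    (exteriorRep_dualLine exteriorRep_vol₃ 3 fun g => g⁻¹.2.2) rfl rfl

/-- The right-handed electron as `Λ³ℂ³`, and its antiparticle as `Λ²ℂ²`. -/
def electronRPair : EquivariantPair electronR :=
  EquivariantPair.ofParticle (L := line 1) (M := line vol₃) (L' := dualLine vol₂)
    (M' := dualLine 1)
    (exteriorRep_line exteriorRep_one 2 fun g => g.2.1)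
    (exteriorRep_line exteriorRep_vol₃ 3 fun g => g.2.2)
    (exteriorRep_dualLine exteriorRep_vol₂ 2 fun g => g⁻¹.2.1)
    (exteriorRep_dualLine exteriorRep_one 3 fun g => g⁻¹.2.2) rfl rfl

/-- Right-handed up quarks as `Λ²ℂ² ⊗ Λ¹ℂ³`, and their antiparticles as `Λ²ℂ³`. -/
def upRPair : EquivariantPair upR :=
  EquivariantPair.ofParticle (L := line vol₂) (M := form₃) (L' := dualLine 1) (M' := star₃)
    (exteriorRep_line exteriorRep_vol₂ 2 fun g => g.2.1) exteriorRep_form₃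
    (exteriorRep_dualLine exteriorRep_one 2 fun g => g⁻¹.2.1) exteriorRep_star₃ rfl rfl

/-- Right-handed down quarks as `Λ¹ℂ³`, and their antiparticles as `Λ²ℂ² ⊗ Λ²ℂ³`. -/
def downRPair : EquivariantPair downR :=
  EquivariantPair.ofParticle (L := line 1) (M := form₃) (L' := dualLine vol₂) (M' := star₃)
    (exteriorRep_line exteriorRep_one 2 fun g => g.2.1) exteriorRep_form₃
    (exteriorRep_dualLine exteriorRep_vol₂ 2 fun g => g⁻¹.2.1) exteriorRep_star₃ rfl rfl

/-- The equivariant maps from `F` and its dual to `Λ*ℂ⁵`. -/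
def fermionPair : EquivariantPair fermionRep :=
  leptonLPair.prod (quarkLPair.prod (neutrinoRPair.prod (electronRPair.prod
    (upRPair.prod downRPair))))

theorem range_form₂_le : LinearMap.range form₂ ≤ LinearMap.range star₂ := by
  rintro _ ⟨v, rfl⟩
  exact form₂_mem_range_star₂ v

theorem fermionPair_range : fermionPair.range = ⊤ := by
  have c1 := EquivariantPair.range_prod_right upRPair downRPair
  have c2 := EquivariantPair.range_prod_left upRPair downRPair
  have c3 := EquivariantPair.range_prod_right electronRPair (upRPair.prod downRPair)
  have c4 := EquivariantPair.range_prod_left electronRPair (upRPair.prod downRPair)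
  have c5 := EquivariantPair.range_prod_right neutrinoRPair
    (electronRPair.prod (upRPair.prod downRPair))
  have c6 := EquivariantPair.range_prod_left neutrinoRPair
    (electronRPair.prod (upRPair.prod downRPair))
  have c7 := EquivariantPair.range_prod_right quarkLPair
    (neutrinoRPair.prod (electronRPair.prod (upRPair.prod downRPair)))
  have c8 := EquivariantPair.range_prod_left quarkLPair
    (neutrinoRPair.prod (electronRPair.prod (upRPair.prod downRPair)))
  have hl : leptonLPair.range ≤ fermionPair.range := EquivariantPair.range_prod_left _ _
  have c9 : _ ≤ fermionPair.range := EquivariantPair.range_prod_right leptonLPair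
    (quarkLPair.prod (neutrinoRPair.prod (electronRPair.prod (upRPair.prod downRPair))))
  have hq : quarkLPair.range ≤ fermionPair.range := c8.trans c9
  have hn : neutrinoRPair.range ≤ fermionPair.range := c6.trans (c7.trans c9)
  have he : electronRPair.range ≤ fermionPair.range := c4.trans (c5.trans (c7.trans c9))
  have hu : upRPair.range ≤ fermionPair.range := c2.trans (c3.trans (c5.trans (c7.trans c9)))
  have hd : downRPair.range ≤ fermionPair.range := c1.trans (c3.trans (c5.trans (c7.trans c9)))
  have p1 : _ ≤ leptonLPair.range := EquivariantPair.range_mul_range_le_ofParticle ..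
  have p2 : _ ≤ leptonLPair.range := EquivariantPair.range_dual_mul_range_dual_le_ofParticle ..
  have p3 : _ ≤ quarkLPair.range := EquivariantPair.range_mul_range_le_ofParticle ..
  have p4 : _ ≤ quarkLPair.range := EquivariantPair.range_dual_mul_range_dual_le_ofParticle ..
  have p5 : _ ≤ neutrinoRPair.range := EquivariantPair.range_mul_range_le_ofParticle ..
  have p6 : _ ≤ neutrinoRPair.range := EquivariantPair.range_dual_mul_range_dual_le_ofParticle ..
  have p7 : _ ≤ electronRPair.range := EquivariantPair.range_mul_range_le_ofParticle ..
  have p8 : _ ≤ electronRPair.range := EquivariantPair.range_dual_mul_range_dual_le_ofParticle ..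
  have p9 : _ ≤ upRPair.range := EquivariantPair.range_mul_range_le_ofParticle ..
  have p10 : _ ≤ upRPair.range := EquivariantPair.range_dual_mul_range_dual_le_ofParticle ..
  have p11 : _ ≤ downRPair.range := EquivariantPair.range_mul_range_le_ofParticle ..
  have p12 : _ ≤ downRPair.range := EquivariantPair.range_dual_mul_range_dual_le_ofParticle ..
  simp only [range_line, range_dualLine] at p1 p2 p3 p4 p5 p6 p7 p8 p9 p10 p11 p12
  rw [eq_top_iff, ← ext₂_mul_ext₃, ext₂, ext₃]
  simp only [Submodule.sup_mul, Submodule.mul_sup]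
  -- Antileptons and antiquarks of this doublet enter through `star₂`, whose range contains `Λ¹ℂ²`.
  have hm : ∀ N : Submodule ℂ Ext5, LinearMap.range form₂ * N ≤ LinearMap.range star₂ * N :=
    fun N => mul_le_mul' range_form₂_le le_rfl
  -- The twelve pieces are grouped by degree in `ℂ³`, and within each group by degree in `ℂ²`.
  exact sup_le (sup_le (sup_le (sup_le (sup_le (p5.trans hn) ((hm _).trans (p2.trans hl)))
    (p8.trans he)) (sup_le (sup_le (p11.trans hd) (p3.trans hq)) (p9.trans hu)))
    (sup_le (sup_le (p10.trans hu) ((hm _).trans (p4.trans hq))) (p12.trans hd)))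
    (sup_le (sup_le (p7.trans he) (p1.trans hl)) (p6.trans hn))

theorem finrank_fermionSpace : Module.finrank ℂ FermionSpace = 16 := by
  simp [FermionSpace]

/-- The equivalence of `F ⊕ F̄` with the restriction of `Λ*ℂ⁵` to `G_SM`. -/
def standardModelEquiv : standardModelRep.Equiv (exteriorRep.comp phi) :=
  fermionPair.equiv fermionPair_range finrank_fermionSpace

/-! ### The kernel of `φ` -/

theorem mem_Z6 {g : GSM} : g ∈ Z6 ↔ g.1 ^ 6 = 1 ∧
    (g.2.1 : Matrix (Fin 2) (Fin 2) ℂ) = Matrix.scalar (Fin 2) ((g.1⁻¹ ^ 3 : Circle) : ℂ) ∧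
    (g.2.2 : Matrix (Fin 3) (Fin 3) ℂ) = Matrix.scalar (Fin 3) ((g.1 ^ 2 : Circle) : ℂ) := Iff.rfl

theorem smul_eq_one_iff {n : ℕ} (c : Circle) (M : Matrix (Fin n) (Fin n) ℂ) :
    (c : ℂ) • M = 1 ↔ M = Matrix.scalar (Fin n) ((c⁻¹ : Circle) : ℂ) := by
  have hc : (c : ℂ) ≠ 0 := Circle.coe_ne_zero c
  rw [Circle.coe_inv, Matrix.scalar_apply, ← Matrix.smul_one_eq_diagonal, eq_inv_smul_iff₀ hc]

/-- Triviality of the blocks gives `A = α⁻³` and `B = α²`; the condition `α ^ 6 = 1` is then `det A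
= 1`. -/
theorem phi_ker : phi.ker = Z6 := by
  ext g
  have h1 : g ∈ phi.ker ↔ blockMatrix g = 1 := by
    rw [MonoidHom.mem_ker, Subtype.ext_iff]
    change Matrix.reindexAlgEquiv ℂ ℂ finSumFinEquiv (blockMatrix g) = 1 ↔ _
    exact map_eq_one_iff _ (Matrix.reindexAlgEquiv ℂ ℂ finSumFinEquiv).injective
  rw [h1, mem_Z6, blockMatrix, ← Matrix.fromBlocks_one, Matrix.fromBlocks_inj, smul_eq_one_iff,
    smul_eq_one_iff]
  simp only [inv_pow, inv_inv, true_and]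
  refine ⟨fun h => ⟨?_, h⟩, fun h => h.2⟩
  have hdet := (Matrix.mem_specialUnitaryGroup_iff.1 g.2.1.2).2
  rw [h.1] at hdet
  simp only [Matrix.scalar_apply, Matrix.det_diagonal, Finset.prod_const, Finset.card_univ,
    Fintype.card_fin] at hdet
  rw [← Circle.coe_pow, Circle.coe_eq_one, inv_pow, inv_eq_one, ← pow_mul] at hdet
  exact hdet

theorem scalar_mem_specialUnitaryGroup {n : ℕ} {c : Circle} (hc : c ^ n = 1) :
    Matrix.scalar (Fin n) (c : ℂ) ∈ Matrix.specialUnitaryGroup (Fin n) ℂ := by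
  rw [Matrix.mem_specialUnitaryGroup_iff, Matrix.mem_unitaryGroup_iff]
  constructor
  · have h : star (Matrix.scalar (Fin n) (c : ℂ)) = Matrix.scalar (Fin n) (star (c : ℂ)) := by
      ext i j; simp [Matrix.star_apply, Matrix.diagonal_apply, eq_comm, apply_ite star]
    rw [h, ← map_mul]
    have : (c : ℂ) * star (c : ℂ) = 1 := by
      rw [← starRingEnd_apply, ← Circle.coe_inv_eq_conj, ← Circle.coe_mul, mul_inv_cancel,
        Circle.coe_one]
    rw [this, map_one]
  · simp only [Matrix.scalar_apply, Matrix.det_diagonal, Finset.prod_const, Finset.card_univ,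
      Fintype.card_fin]
    rw [← Circle.coe_pow, hc, Circle.coe_one]

/-- The homomorphism `(α, A, B) ↦ α` from `ℤ₆` to the group of sixth roots of unity. -/
def toRootsOfUnity : Z6 →* rootsOfUnity 6 ℂ where
  toFun g := ⟨Circle.toUnits g.1.1, by
    rw [mem_rootsOfUnity, ← map_pow, (mem_Z6.1 g.2).1, map_one]⟩
  map_one' := Subtype.ext (map_one Circle.toUnits)
  map_mul' g h := Subtype.ext (map_mul Circle.toUnits g.1.1 h.1.1)

/-- The scalar `α` determines the other two entries. Conversely `α ^ 6 = 1` makes both determinants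
`(α⁻³) ^ 2` and `(α²) ^ 3` equal to one. -/
theorem toRootsOfUnity_bijective : Function.Bijective toRootsOfUnity := by
  constructor
  · rintro ⟨g, hg⟩ ⟨h, hh⟩ e
    have e1 : g.1 = h.1 :=
      Subtype.ext (congrArg (fun u : rootsOfUnity 6 ℂ => ((u : ℂˣ) : ℂ)) e)
    obtain ⟨-, hg2, hg3⟩ := mem_Z6.1 hg
    obtain ⟨-, hh2, hh3⟩ := mem_Z6.1 hh
    exact Subtype.ext (Prod.ext e1 (Prod.ext (Subtype.ext (by rw [hg2, hh2, e1]))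
      (Subtype.ext (by rw [hg3, hh3, e1]))))
  · rintro ⟨u, hu⟩
    have hu6 : (u : ℂ) ^ 6 = 1 := by
      rw [← Units.val_pow_eq_pow_val, (mem_rootsOfUnity 6 u).1 hu, Units.val_one]
    have hu1 : ‖(u : ℂ)‖ = 1 := Complex.norm_eq_one_of_pow_eq_one hu6 (by norm_num)
    let a : Circle := ⟨u, mem_sphere_zero_iff_norm.2 hu1⟩
    have ha : a ^ 6 = 1 := Circle.ext (by rw [Circle.coe_pow, Circle.coe_one]; exact hu6)
    have h2 : (a⁻¹ ^ 3) ^ 2 = 1 := by rw [← pow_mul, inv_pow, ha, inv_one]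
    have h3 : (a ^ 2) ^ 3 = 1 := by rw [← pow_mul, ha]
    exact ⟨⟨(a, ⟨_, scalar_mem_specialUnitaryGroup h2⟩, ⟨_, scalar_mem_specialUnitaryGroup h3⟩),
      ha, rfl, rfl⟩, Subtype.ext (Units.ext rfl)⟩

/-- The isomorphism of `ℤ₆` with the group of sixth roots of unity. -/
def Z6Equiv : Z6 ≃* rootsOfUnity 6 ℂ := MulEquiv.ofBijective _ toRootsOfUnity_bijective

theorem Z6_isCyclic : IsCyclic Z6 :=
  isCyclic_of_surjective Z6Equiv.symm Z6Equiv.symm.surjective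

theorem card_Z6 : Nat.card Z6 = 6 := by
  rw [Nat.card_congr Z6Equiv.toEquiv, Complex.card_rootsOfUnity]

/-! ### Topology -/

theorem isCompact_specialUnitaryGroup (n : ℕ) :
    IsCompact (Matrix.specialUnitaryGroup (Fin n) ℂ : Set (Matrix (Fin n) (Fin n) ℂ)) := by
  have hclosed : IsClosed (Matrix.specialUnitaryGroup (Fin n) ℂ :
      Set (Matrix (Fin n) (Fin n) ℂ)) := by
    have h : (Matrix.specialUnitaryGroup (Fin n) ℂ : Set (Matrix (Fin n) (Fin n) ℂ)) =
        {A | A * A.conjTranspose = 1} ∩ {A | A.det = 1} := by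
      ext A
      exact Matrix.mem_specialUnitaryGroup_iff.trans
        (and_congr_left' Matrix.mem_unitaryGroup_iff)
    rw [h]
    exact (isClosed_eq (by fun_prop) continuous_const).inter
      (isClosed_eq (by fun_prop) continuous_const)
  have hsub : (Matrix.specialUnitaryGroup (Fin n) ℂ : Set (Matrix (Fin n) (Fin n) ℂ)) ⊆
      Set.univ.pi fun _ : Fin n => Set.univ.pi fun _ : Fin n => Metric.closedBall (0 : ℂ) 1 := by
    intro A hA i _ j _
    rw [mem_closedBall_zero_iff]
    exact entry_norm_bound_of_unitary (Matrix.mem_specialUnitaryGroup_iff.1 hA).1 i j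
  exact IsCompact.of_isClosed_subset (isCompact_univ_pi fun _ => isCompact_univ_pi fun _ =>
    isCompact_closedBall _ _) hclosed hsub

instance (n : ℕ) : CompactSpace (SU n) :=
  isCompact_iff_compactSpace.1 (isCompact_specialUnitaryGroup n)

theorem continuous_phi : Continuous phi := by
  refine Continuous.subtype_mk (f := fun g =>
    Matrix.reindexAlgEquiv ℂ ℂ finSumFinEquiv (blockMatrix g)) ?_ _
  have h : Continuous blockMatrix := by
    unfold blockMatrix
    refine Continuous.matrix_fromBlocks ?_ continuous_const continuous_const ?_ <;> fun_prop
  exact h.matrix_submatrix _ _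

/-- The embedding `G_SM / ℤ₆ → Spin(10)`. -/
def quotientEmbedding : GSM ⧸ Z6 →* Spin10 :=
  QuotientGroup.lift Z6 (spinLift.comp phi) fun g hg => by
    rw [MonoidHom.mem_ker, MonoidHom.comp_apply, show phi g = 1 from phi_ker.ge hg, map_one]

theorem quotientEmbedding_mk (g : GSM) :
    quotientEmbedding (QuotientGroup.mk g) = spinLift (phi g) := rfl

theorem quotientEmbedding_injective : Function.Injective quotientEmbedding := by
  rw [injective_iff_map_eq_one]
  intro x hx
  obtain ⟨g, rfl⟩ := QuotientGroup.mk_surjective x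
  rw [quotientEmbedding_mk] at hx
  rw [QuotientGroup.eq_one_iff, ← phi_ker]
  exact spinLift_injective (hx.trans (map_one _).symm)

theorem quotientEmbedding_isClosedEmbedding : Topology.IsClosedEmbedding quotientEmbedding := by
  have : CompactSpace (GSM ⧸ Z6) := Quotient.compactSpace
  have hc : Continuous quotientEmbedding :=
    Continuous.quotient_lift (continuous_spinLift.comp continuous_phi) _
  exact hc.isClosedEmbedding quotientEmbedding_injective

/-! ### The representation of `G_SM / ℤ₆` on the fermions -/

/-- No hypercharge computation is needed: the representation is equivalent to one that factors
through `φ`, whose kernel is `ℤ₆`. -/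
theorem standardModelRep_eq_one {g : GSM} (hg : g ∈ Z6) : standardModelRep g = 1 := by
  refine LinearMap.ext fun x => standardModelEquiv.toLinearEquiv.injective ?_
  have h := LinearMap.congr_fun (standardModelEquiv.isIntertwining' g) x
  have hp : (exteriorRep.comp phi) g = 1 := by
    rw [MonoidHom.comp_apply, show phi g = 1 from phi_ker.ge hg, map_one]
  rw [hp] at h
  exact h

/-- The representation of `G_SM / ℤ₆` on `F ⊕ F̄`. -/
def quotientRep : Representation ℂ (GSM ⧸ Z6) (FermionSpace × Module.Dual ℂ FermionSpace) :=
  QuotientGroup.lift Z6 standardModelRep fun _ hg => standardModelRep_eq_one hg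

theorem quotientRep_mk (g : GSM) : quotientRep (QuotientGroup.mk g) = standardModelRep g := rfl

/-- The equivalence of `F ⊕ F̄` with the Dirac spinor representation restricted to
`G_SM / ℤ₆`. -/
def quotientEquiv : quotientRep.Equiv (MonoidHom.comp diracRep quotientEmbedding) :=
  Representation.Equiv.mk standardModelEquiv.toLinearEquiv fun x => by
    obtain ⟨g, rfl⟩ := QuotientGroup.mk_surjective x
    rw [quotientRep_mk, MonoidHom.comp_apply, quotientEmbedding_mk, diracRep_spinLift]
    exact standardModelEquiv.isIntertwining' g

end

end SpinGUT

theorem mainTheorem4 :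
    (IsCyclic Z6 ∧ Nat.card Z6 = 6 ∧ phi.ker = Z6) ∧
    (IsCompl deltaPlus.toSubmodule deltaMinus.toSubmodule ∧
      deltaPlus.toRepresentation.IsIrreducible ∧
      deltaMinus.toRepresentation.IsIrreducible ∧
      IsEmpty (deltaPlus.toRepresentation.Equiv deltaMinus.toRepresentation)) ∧
    ∃ (ψ : SU 5 →* Spin10) (j : GSM ⧸ Z6 →* Spin10)
      (σ : Representation ℂ (GSM ⧸ Z6) (FermionSpace × Module.Dual ℂ FermionSpace)),
      Continuous ψ ∧ Function.Injective ψ ∧ (∀ A : SU 5, diracRep (ψ A) = exteriorRep A) ∧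
      (∀ g : GSM, j (QuotientGroup.mk g) = ψ (phi g)) ∧
      Topology.IsClosedEmbedding j ∧
      (∀ g : GSM, σ (QuotientGroup.mk g) = standardModelRep g) ∧
      Nonempty (σ.Equiv (MonoidHom.comp diracRep j)) :=
  ⟨⟨Z6_isCyclic, card_Z6, phi_ker⟩,
    ⟨isCompl_extParity, weyl_isIrreducible 0, weyl_isIrreducible 1,
      deltaPlus_not_equiv_deltaMinus⟩,
    spinLift, quotientEmbedding, quotientRep, continuous_spinLift, spinLift_injective,
    diracRep_spinLift, quotientEmbedding_mk, quotientEmbedding_isClosedEmbedding, quotientRep_mk,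
    ⟨quotientEquiv⟩⟩
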